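/- Let $l\ge 1$. Take three $2l\times 2l$ grids $A,B,C$ with top rows $a_1,\dots,a_l,a'_l,\dots,a'_1$; $\;b_1,\dots,b_l,b'_l,\dots,b'_1$; $\;c_1,\dots,c_l,c'_l,\dots,c'_1$ (from left to right). A Todinca graph of order $l$ is obtained by adding three perfect matchings, between $\{a_i\}$ and $\{b'_i\}$, between $\{b_i\}$ and $\{c'_i\}$, and between $\{c_i\}$ and $\{a'_i\}$. Let $k>0$ and $p>1$ be integers. A $p$-handle links two paths $p_1,\dots,p_{5p}$ and $q_1,\dots,q_{5p}$ by the edges $p_iq_i$ ($1\le i\le p$ and $4p+1\le i\le 5p$), $p_{p+i}q_{2p+i}$ ($1\le i\le 2p$) and $p_{3p+i}q_{p+i}$ ($1\le i\le p$). A $p$-crosscap links two paths $p_1,\dots,p_{3p}$ and $q_1,\dots,q_{3p}$ by the edges $p_iq_i$ ($1\le i\le p$ and $2p+1\le i\le 3p$) and $p_{p+i}q_{2p+1-i}$ ($1\le i\le p$). Let $G_{k,p}$ be the Todinca graph of order $l=5kp$ with the edges $a_ib'_i$ and $c_ia'_i$ ($1\le i\le l$) in which $b_1,\dots,b_l$ and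 $c'_1,\dots,c'_l$ are linked by $k$ consecutive $p$-handles; let $\widetilde G_{k,p}$ be the Todinca graph of order $l=3kp$ defined in the same way with $k$ consecutive $p$-crosscaps. Let $\Gamma_{k,p}$ be the 2-cell embedding of $G_{k,p}$ in the orientable surface with $k$ handles (Euler genus $2k$) obtained as follows: draw the three grids in the sphere with the same orientation around a common centre, with their top rows turned towards the centre; draw all the edges between the grids except the edges $p_{3p+i}q_{p+i}$ of the $p$-handles; then, for each $p$-handle, add a handle to the surface that carries its $p$ remaining edges. Let $\widetilde\Gamma_{k,p}$ be the 2-cell embedding of $\widetilde G_{k,p}$ in the non-orientable surface with $k$ crosscaps obtained in the same way, where for each $p$-crosscap a crosscap is added to the surface through which the edges $p_{p+i}q_{2p+1-i}$ pass. (In terms of rotation systems: at every vertex the existing edges have the cyclic order up, left, down, right, where at a top row vertex the edge to another grid points up; no edge of $\Gamma_{k,p}$ is twisted, and the twisted edges of $\widetilde\Gamma_{k,p}$ are exactly the edges $p_{p+i}q_{2p+1-i}$.) The dual $\Gamma^*$ of a 2-cell embedding $\Gamma$ has one vertex for each face of $\Gamma$ and, for each edge of $\Gamma$, one edge that links the faces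 on its two sides. Write $\operatorname{tw}$ for tree-width. **Lemma.** For all integers $k>0$ and $p>1$, $$\operatorname{tw}(\Gamma_{k,p}^*)\le 15kp-2-2k\qquad\text{and}\qquad \operatorname{tw}(\widetilde\Gamma_{k,p}^*)\le 9kp-2-k .$$ -/

import Mathlib

/-! ### Tree-width of a multigraph -/

/-- A tree-decomposition of a (multi)graph `H`: a finite tree `T` and a bag of vertices of `H` at
every node of `T`, such that both ends of every edge lie in a common bag and, for every vertex `v`,
the nodes whose bag contains `v` induce a non-empty subtree of `T`. -/
structure TreeDecomposition {α β : Type} (H : Graph α β) where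
  Node : Type
  finite_node : Finite Node
  T : SimpleGraph Node
  isTree : T.IsTree
  bag : Node → Set α
  bag_subset : ∀ t, bag t ⊆ H.vertexSet
  exists_bag_of_isLink : ∀ e x y, H.IsLink e x y → ∃ t, x ∈ bag t ∧ y ∈ bag t
  connected_of_mem : ∀ v ∈ H.vertexSet, (T.induce {t | v ∈ bag t}).Connected

/-- The width of a tree-decomposition: the maximum of `|bag t| - 1`. -/
noncomputable def TreeDecomposition.width {α β : Type} {H : Graph α β}
    (D : TreeDecomposition H) : ℕ∞ :=
  ⨆ t, ((D.bag t).encard - 1)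

/-- The tree-width: the minimum width of a tree-decomposition. -/
noncomputable def treewidth {α β : Type} (H : Graph α β) : ℕ∞ :=
  ⨅ D : TreeDecomposition H, D.width

/-! ### Embeddings in surfaces and their duals -/

/-- A 2-cell embedding, up to homeomorphism, of a connected graph `G` (with at least one edge) in a
closed surface, given by a rotation system with signature: `rot` sends a dart `uv` to the next dart
around `u`, for a local orientation of the surface chosen at `u`, and `twist` says for which edges
the local orientations at the two ends disagree along the edge.  The surface is obtained by gluing a
disc to every facial walk. -/
structure CellularEmbedding {V : Type} (G : SimpleGraph V) where
  rot : Equiv.Perm G.Dart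
  rot_fst : ∀ d, (rot d).fst = d.fst
  rot_cyclic : ∀ d d' : G.Dart, d.fst = d'.fst → rot.SameCycle d d'
  twist : Sym2 V → Bool

namespace CellularEmbedding

variable {V : Type} {G : SimpleGraph V} (Γ : CellularEmbedding G)

/-- The pair `(d, true)` stands for the side of the dart `d` that is turned towards `rot d`, near
the initial vertex of `d`, and `(d, false)` for its other side.  `FaceStep` relates sides that
belong to the same face for one of the two elementary reasons: they bound the same corner between
consecutive darts at a vertex, or they are the same side of an edge seen from its two ends. -/
inductive FaceStep : G.Dart × Bool → G.Dart × Bool → Prop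
  | corner (d : G.Dart) : FaceStep (d, true) (Γ.rot d, false)
  | along (d : G.Dart) (s : Bool) : FaceStep (d, s) (d.symm, xor (!s) (Γ.twist d.edge))

/-- The faces of the embedding: the classes of the equivalence relation generated by
`FaceStep`. -/
def Face : Type := Quot Γ.FaceStep

/-- The face that contains a given side of a dart. -/
def face (x : G.Dart × Bool) : Γ.Face := Quot.mk _ x

theorem face_symm (d : G.Dart) (s : Bool) :
    Γ.face (d.symm, s) = Γ.face (d, xor (!s) (Γ.twist d.edge)) := by
  have h := Quot.sound (FaceStep.along (Γ := Γ) d (xor (!s) (Γ.twist d.edge)))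
  have h2 : xor (!(xor (!s) (Γ.twist d.edge))) (Γ.twist d.edge) = s := by
    cases s <;> cases Γ.twist d.edge <;> rfl
  rw [h2] at h
  exact h.symm

/-- The graph of the dual embedding: its vertices are the faces, and every edge `e` gives one dual
edge (with the same name), which links the faces on the two sides of `e`. -/
def dual : Graph Γ.Face (Sym2 V) where
  vertexSet := Set.univ
  edgeSet := G.edgeSet
  IsLink e f g := ∃ (d : G.Dart) (s : Bool),
    d.edge = e ∧ Γ.face (d, s) = f ∧ Γ.face (d, !s) = g
  isLink_symm e _ := ⟨by
    rintro f g ⟨d, s, rfl, rfl, rfl⟩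
    exact ⟨d, !s, rfl, rfl, by simp⟩⟩
  eq_or_eq_of_isLink_of_isLink := by
    rintro e x y v w ⟨d, s, rfl, rfl, rfl⟩ ⟨d', s', h, rfl, rfl⟩
    rcases (SimpleGraph.dart_edge_eq_iff d' d).1 h with rfl | rfl
    · cases s <;> cases s' <;> simp
    · rw [face_symm, face_symm]
      cases s <;> cases s' <;> cases Γ.twist d.edge <;> simp
  edge_mem_iff_exists_isLink := by
    intro e
    constructor
    · induction e with
      | _ u v =>
        intro h
        exact ⟨_, _, ⟨(u, v), h⟩, true, rfl, rfl, rfl⟩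
    · rintro ⟨_, _, d, _, rfl, _, _⟩
      exact d.edge_mem
  left_mem_of_isLink := fun _ _ _ _ => Set.mem_univ _

end CellularEmbedding

/-! ### Todinca graphs -/

namespace Todinca

/-- The vertices of three `2l × 2l` grids `A = 0`, `B = 1`, `C = 2`.  The vertex `(g, c, r)` lies in
the grid `g`, in column `c` and in row `r`, and row `0` is the top row. -/
abbrev Vertex (l : ℕ) : Type := Fin 3 × Fin (2 * l) × Fin (2 * l)

variable {l : ℕ}

/-- The `i`-th vertex from the left in the top row of a grid: `a_i`, `b_i` or `c_i`. -/
def leftTop (g : Fin 3) (i : Fin l) : Vertex l :=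
  (g, ⟨i, by omega⟩, ⟨0, by have := i.2; omega⟩)

/-- The `i`-th vertex from the right in the top row of a grid: `a'_i`, `b'_i` or `c'_i`. -/
def rightTop (g : Fin 3) (i : Fin l) : Vertex l :=
  (g, ⟨2 * l - 1 - i, by omega⟩, ⟨0, by have := i.2; omega⟩)

/-- The edges that link the three grids: `σ 0`, `σ 1` and `σ 2` are the bijections along which
the `a_i` are linked with the `b'_j`, the `b_i` with the `c'_j` and the `c_i` with the `a'_j`. -/
def Link (σ : Fin 3 → Equiv.Perm (Fin l)) (u v : Vertex l) : Prop :=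
  ∃ (g : Fin 3) (i : Fin l), u = leftTop g i ∧ v = rightTop (g + 1) (σ g i)

theorem link_grid_ne {σ : Fin 3 → Equiv.Perm (Fin l)} {u v : Vertex l} (h : Link σ u v) :
    u.1 ≠ v.1 := by
  obtain ⟨g, i, rfl, rfl⟩ := h
  simp [leftTop, rightTop]

/-- The Todinca graph of order `l` with linking bijections `σ`. -/
def graph (σ : Fin 3 → Equiv.Perm (Fin l)) : SimpleGraph (Vertex l) where
  Adj u v :=
    (u.1 = v.1 ∧ (SimpleGraph.pathGraph (2 * l) □ SimpleGraph.pathGraph (2 * l)).Adj u.2 v.2) ∨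
      Link σ u v ∨ Link σ v u
  symm := ⟨by
    rintro u v (⟨h, h'⟩ | h | h)
    · exact Or.inl ⟨h.symm, h'.symm⟩
    · exact Or.inr (Or.inr h)
    · exact Or.inr (Or.inl h)⟩
  loopless := ⟨by
    rintro u (⟨_, h⟩ | h | h)
    · exact h.ne rfl
    · exact link_grid_ne h rfl
    · exact link_grid_ne h rfl⟩

/-- The other end of the linking edge at the top vertex of column `c` in the grid `g`. -/
def topNeighbour (σ : Fin 3 → Equiv.Perm (Fin l)) (g : Fin 3) (c : Fin (2 * l)) : Vertex l :=
  if h : (c : ℕ) < l then rightTop (g + 1) (σ g ⟨c, h⟩)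
  else leftTop (g - 1) ((σ (g - 1)).symm ⟨2 * l - 1 - c, by omega⟩)

/-- The neighbour of a vertex in one of the four directions `0` up, `1` left, `2` down,
`3` right, if there is one.  At a vertex of a top row the linking edge points up. -/
def neighbour (σ : Fin 3 → Equiv.Perm (Fin l)) (v : Vertex l) (d : Fin 4) : Option (Vertex l) :=
  match d with
  | 0 => if 0 < (v.2.2 : ℕ) then some (v.1, v.2.1, ⟨v.2.2 - 1, by omega⟩)
    else some (topNeighbour σ v.1 v.2.1)
  | 1 => if 0 < (v.2.1 : ℕ) then some (v.1, ⟨v.2.1 - 1, by omega⟩, v.2.2) else none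
  | 2 => if h : (v.2.2 : ℕ) + 1 < 2 * l then some (v.1, v.2.1, ⟨v.2.2 + 1, h⟩) else none
  | 3 => if h : (v.2.1 : ℕ) + 1 < 2 * l then some (v.1, ⟨v.2.1 + 1, h⟩, v.2.2) else none

/-- A vertex together with a direction in which it has a neighbour. -/
abbrev Port (σ : Fin 3 → Equiv.Perm (Fin l)) : Type :=
  {x : Vertex l × Fin 4 // (neighbour σ x.1 x.2).isSome = true}

theorem topNeighbour_link (σ : Fin 3 → Equiv.Perm (Fin l)) (g : Fin 3) (c : Fin (2 * l))
    (h0 : 0 < 2 * l) :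
    Link σ (g, c, ⟨0, h0⟩) (topNeighbour σ g c) ∨ Link σ (topNeighbour σ g c) (g, c, ⟨0, h0⟩) := by
  unfold topNeighbour
  split_ifs with h
  · exact Or.inl ⟨g, ⟨c, h⟩, rfl, rfl⟩
  · refine Or.inr ⟨g - 1, _, rfl, ?_⟩
    have : 2 * l - 1 - (2 * l - 1 - (c : ℕ)) = c := by omega
    simp [rightTop, this]

theorem link_topNeighbour {σ : Fin 3 → Equiv.Perm (Fin l)} {u v : Vertex l}
    (h : Link σ u v ∨ Link σ v u) : (u.2.2 : ℕ) = 0 ∧ topNeighbour σ u.1 u.2.1 = v := by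
  rcases h with ⟨g, i, rfl, rfl⟩ | ⟨g, i, rfl, rfl⟩
  · exact ⟨rfl, by simp [topNeighbour, leftTop]⟩
  · refine ⟨rfl, ?_⟩
    have h1 : ¬ (2 * l - 1 - ((σ g i : Fin l) : ℕ) < l) := by omega
    have h2 : 2 * l - 1 - (2 * l - 1 - ((σ g i : Fin l) : ℕ)) = (σ g i : Fin l) := by omega
    simp [topNeighbour, rightTop, h1, h2]

theorem adj_of_neighbour {σ : Fin 3 → Equiv.Perm (Fin l)} {u v : Vertex l} {d : Fin 4}
    (h : neighbour σ u d = some v) : (graph σ).Adj u v := by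
  obtain ⟨g, c, r⟩ := u
  fin_cases d
  · simp only [neighbour] at h
    split_ifs at h with h1
    · obtain rfl := Option.some.inj h
      refine Or.inl ⟨rfl, ?_⟩
      simp [SimpleGraph.boxProd_adj, SimpleGraph.pathGraph_adj]
      omega
    · obtain rfl := Option.some.inj h
      have h0 : 0 < 2 * l := by have := c.2; omega
      obtain rfl : r = ⟨0, h0⟩ := Fin.ext (by simpa using h1)
      exact Or.inr (topNeighbour_link σ g c h0)
  · simp only [neighbour] at h
    split_ifs at h with h1
    obtain rfl := Option.some.inj h
    refine Or.inl ⟨rfl, ?_⟩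
    simp [SimpleGraph.boxProd_adj, SimpleGraph.pathGraph_adj]
    omega
  · simp only [neighbour] at h
    split_ifs at h with h1
    obtain rfl := Option.some.inj h
    refine Or.inl ⟨rfl, ?_⟩
    simp [SimpleGraph.boxProd_adj, SimpleGraph.pathGraph_adj]
  · simp only [neighbour] at h
    split_ifs at h with h1
    obtain rfl := Option.some.inj h
    refine Or.inl ⟨rfl, ?_⟩
    simp [SimpleGraph.boxProd_adj, SimpleGraph.pathGraph_adj]

theorem exists_neighbour_of_adj {σ : Fin 3 → Equiv.Perm (Fin l)} {u v : Vertex l}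
    (h : (graph σ).Adj u v) : ∃ d, neighbour σ u d = some v := by
  rcases h with ⟨h, h'⟩ | h
  · obtain ⟨g, c, r⟩ := u
    obtain ⟨g', c', r'⟩ := v
    obtain rfl : g = g' := h
    simp only [SimpleGraph.boxProd_adj, SimpleGraph.pathGraph_adj] at h'
    rcases h' with ⟨h1 | h1, h2⟩ | ⟨h1 | h1, h2⟩
    · refine ⟨3, ?_⟩
      have : (c : ℕ) + 1 < 2 * l := by omega
      simp [neighbour, Fin.ext_iff, this]
      exact ⟨h1, by rw [h2]⟩
    · refine ⟨1, ?_⟩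
      have : 0 < (c : ℕ) := by omega
      simp only [neighbour, this, if_true, h2, Option.some.injEq, Prod.mk.injEq, Fin.ext_iff]
      refine ⟨trivial, by omega, trivial⟩
    · refine ⟨2, ?_⟩
      have : (r : ℕ) + 1 < 2 * l := by omega
      simp [neighbour, Fin.ext_iff, this]
      exact ⟨by rw [h2], h1⟩
    · refine ⟨0, ?_⟩
      have : 0 < (r : ℕ) := by omega
      simp only [neighbour, this, if_true, h2, Option.some.injEq, Prod.mk.injEq, Fin.ext_iff]
      refine ⟨trivial, trivial, by omega⟩
  · obtain ⟨h1, h2⟩ := link_topNeighbour h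
    exact ⟨0, by simp [neighbour, h1, h2]⟩

theorem topNeighbour_fst_ne (σ : Fin 3 → Equiv.Perm (Fin l)) (g : Fin 3) (c : Fin (2 * l)) :
    (topNeighbour σ g c).1 ≠ g := by
  have h0 : 0 < 2 * l := by have := c.2; omega
  rcases topNeighbour_link σ g c h0 with h | h
  · exact (link_grid_ne h).symm
  · exact link_grid_ne h

theorem neighbour_inj {σ : Fin 3 → Equiv.Perm (Fin l)} {u v : Vertex l} {d d' : Fin 4}
    (h : neighbour σ u d = some v) (h' : neighbour σ u d' = some v) : d = d' := by
  obtain ⟨g, c, r⟩ := u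
  obtain ⟨g', c', r'⟩ := v
  have key := topNeighbour_fst_ne σ g c
  have key' : topNeighbour σ g c = (g', c', r') → g ≠ g' := by
    intro e; rw [e] at key; exact key.symm
  fin_cases d <;> fin_cases d' <;> first
    | rfl
    | (exfalso
       simp only [neighbour] at h h'
       split_ifs at h h' <;>
       simp only [Option.some.injEq, Prod.mk.injEq, Fin.ext_iff] at h h' <;>
       first
         | omega
         | exact key' h h'.1.symm.symm
         | exact key' h (Fin.ext h'.1)
         | exact key' h' (Fin.ext h.1))

/-- The dart that leaves a vertex in a given direction. -/
def portToDart (σ : Fin 3 → Equiv.Perm (Fin l)) (x : Port σ) : (graph σ).Dart :=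
  ⟨(x.1.1, (neighbour σ x.1.1 x.1.2).get x.2), adj_of_neighbour (Option.some_get x.2).symm⟩

theorem portToDart_bijective (σ : Fin 3 → Equiv.Perm (Fin l)) :
    Function.Bijective (portToDart σ) := by
  constructor
  · rintro ⟨⟨u, d⟩, hx⟩ ⟨⟨u', d'⟩, hy⟩ h
    have h1 := congrArg (fun e : (graph σ).Dart => e.fst) h
    have h2 := congrArg (fun e : (graph σ).Dart => e.snd) h
    obtain rfl : u = u' := h1
    have h3 : (neighbour σ u d).get hx = (neighbour σ u d').get hy := h2
    have h4 : neighbour σ u d' = some ((neighbour σ u d).get hx) := by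
      rw [h3]; exact (Option.some_get hy).symm
    obtain rfl : d = d' := neighbour_inj (Option.some_get hx).symm h4
    rfl
  · rintro ⟨⟨u, v⟩, h⟩
    obtain ⟨d, hd⟩ := exists_neighbour_of_adj h
    refine ⟨⟨(u, d), by simp [hd]⟩, ?_⟩
    simp [portToDart, hd]

/-- The darts of a Todinca graph are the pairs of a vertex and a direction in which it has a
neighbour. -/
noncomputable def portEquivDart (σ : Fin 3 → Equiv.Perm (Fin l)) : Port σ ≃ (graph σ).Dart :=
  Equiv.ofBijective (portToDart σ) (portToDart_bijective σ)

/-- The first direction after `d`, in the cyclic order up, left, down, right, that is present. -/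
def nextDir (P : Fin 4 → Bool) (d : Fin 4) : Fin 4 :=
  if P (d + 1) then d + 1 else if P (d + 2) then d + 2 else if P (d + 3) then d + 3 else d

/-- The last direction before `d`, in the cyclic order up, left, down, right, that is present. -/
def prevDir (P : Fin 4 → Bool) (d : Fin 4) : Fin 4 :=
  if P (d - 1) then d - 1 else if P (d - 2) then d - 2 else if P (d - 3) then d - 3 else d

theorem nextDir_present : ∀ (P : Fin 4 → Bool) (d : Fin 4), P d = true →
    P (nextDir P d) = true := by decide

theorem prevDir_present : ∀ (P : Fin 4 → Bool) (d : Fin 4), P d = true →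
    P (prevDir P d) = true := by decide

theorem prevDir_nextDir : ∀ (P : Fin 4 → Bool) (d : Fin 4), P d = true →
    prevDir P (nextDir P d) = d := by decide

theorem nextDir_prevDir : ∀ (P : Fin 4 → Bool) (d : Fin 4), P d = true →
    nextDir P (prevDir P d) = d := by decide

theorem exists_iterate_nextDir : ∀ (P : Fin 4 → Bool) (d : Fin 4), P d = true → P 0 = true →
    ∃ j : Fin 4, (nextDir P)^[(j : ℕ)] d = 0 := by decide

/-- The rotation: at every vertex, the directions up, left, down, right that are present follow
each other cyclically in this order. -/
def portRot (σ : Fin 3 → Equiv.Perm (Fin l)) : Equiv.Perm (Port σ) where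
  toFun x := ⟨(x.1.1, nextDir (fun d => (neighbour σ x.1.1 d).isSome) x.1.2),
    nextDir_present (fun d => (neighbour σ x.1.1 d).isSome) x.1.2 x.2⟩
  invFun x := ⟨(x.1.1, prevDir (fun d => (neighbour σ x.1.1 d).isSome) x.1.2),
    prevDir_present (fun d => (neighbour σ x.1.1 d).isSome) x.1.2 x.2⟩
  left_inv x := Subtype.ext (Prod.ext rfl
    (prevDir_nextDir (fun d => (neighbour σ x.1.1 d).isSome) x.1.2 x.2))
  right_inv x := Subtype.ext (Prod.ext rfl
    (nextDir_prevDir (fun d => (neighbour σ x.1.1 d).isSome) x.1.2 x.2))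

theorem neighbour_up_isSome (σ : Fin 3 → Equiv.Perm (Fin l)) (v : Vertex l) :
    (neighbour σ v 0).isSome = true := by
  simp only [neighbour]
  split_ifs <;> rfl

theorem portRot_pow (σ : Fin 3 → Equiv.Perm (Fin l)) (n : ℕ) (x : Port σ) :
    ((portRot σ ^ n) x).1 =
      (x.1.1, (nextDir (fun d => (neighbour σ x.1.1 d).isSome))^[n] x.1.2) := by
  induction n with
  | zero => rfl
  | succ n ih =>
    rw [pow_succ', Equiv.Perm.mul_apply, Function.iterate_succ_apply']
    simp only [portRot, Equiv.coe_fn_mk] at ih ⊢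
    rw [ih]

theorem portRot_sameCycle_up (σ : Fin 3 → Equiv.Perm (Fin l)) (x : Port σ) :
    (portRot σ).SameCycle x ⟨(x.1.1, 0), neighbour_up_isSome σ x.1.1⟩ := by
  obtain ⟨j, hj⟩ := exists_iterate_nextDir (fun d => (neighbour σ x.1.1 d).isSome) x.1.2 x.2
    (neighbour_up_isSome σ x.1.1)
  refine ⟨((j : ℕ) : ℤ), Subtype.ext ?_⟩
  rw [zpow_natCast, portRot_pow, hj]

/-- The embedding of the Todinca graph with linking bijections `σ` in which the three grids are
drawn with the same orientation around a common centre, their top rows turned towards the centre,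
and in which the edges of `twist` are twisted.  Every linking edge is inserted, at each of its
ends, between the two top row edges, on the side opposite to the grid. -/
noncomputable def embedding (σ : Fin 3 → Equiv.Perm (Fin l)) (twist : Sym2 (Vertex l) → Bool) :
    CellularEmbedding (graph σ) where
  rot := (portEquivDart σ).permCongr (portRot σ)
  rot_fst d := by
    obtain ⟨x, rfl⟩ := (portEquivDart σ).surjective d
    rw [Equiv.permCongr_apply, Equiv.symm_apply_apply]
    rfl
  rot_cyclic d d' h := by
    obtain ⟨x, rfl⟩ := (portEquivDart σ).surjective d
    obtain ⟨y, rfl⟩ := (portEquivDart σ).surjective d'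
    have hxy : x.1.1 = y.1.1 := h
    have h1 := portRot_sameCycle_up σ x
    have h2 := portRot_sameCycle_up σ y
    have h3 : (⟨(x.1.1, 0), neighbour_up_isSome σ x.1.1⟩ : Port σ) =
        ⟨(y.1.1, 0), neighbour_up_isSome σ y.1.1⟩ := by simp [hxy]
    obtain ⟨n, hn⟩ := h1.trans (h3 ▸ h2.symm)
    refine ⟨n, ?_⟩
    have h4 : ((portEquivDart σ).permCongr (portRot σ)) ^ n =
        (portEquivDart σ).permCongr (portRot σ ^ n) :=
      (map_zpow (portEquivDart σ).permCongrHom (portRot σ) n).symm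
    rw [h4, Equiv.permCongr_apply, Equiv.symm_apply_apply, hn]
  twist := twist

/-! ### The gadgets -/

/-- The `p`-handle: `p_i` is linked with `q_i` in the first and in the last of five blocks of `p`
indices, `p_{p+i}` with `q_{2p+i}` for `1 ≤ i ≤ 2p`, and `p_{3p+i}` with `q_{p+i}` for
`1 ≤ i ≤ p` (indices start at `0` in the code). -/
def handlePerm (p : ℕ) : Equiv.Perm (Fin (5 * p)) where
  toFun i := ⟨if p ≤ (i : ℕ) ∧ (i : ℕ) < 3 * p then i + p
    else if 3 * p ≤ (i : ℕ) ∧ (i : ℕ) < 4 * p then i - 2 * p else i, by split_ifs <;> omega⟩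
  invFun j := ⟨if 2 * p ≤ (j : ℕ) ∧ (j : ℕ) < 4 * p then j - p
    else if p ≤ (j : ℕ) ∧ (j : ℕ) < 2 * p then j + 2 * p else j, by split_ifs <;> omega⟩
  left_inv i := by
    ext
    dsimp only
    split_ifs <;> omega
  right_inv j := by
    ext
    dsimp only
    split_ifs <;> omega

/-- The `p`-crosscap: `p_i` is linked with `q_i` in the first and in the last of three blocks of
`p` indices, and `p_{p+i}` with `q_{2p+1-i}` for `1 ≤ i ≤ p` (indices start at `0` in the code). -/
def crosscapPerm (p : ℕ) : Equiv.Perm (Fin (3 * p)) where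
  toFun i := ⟨if p ≤ (i : ℕ) ∧ (i : ℕ) < 2 * p then 3 * p - 1 - i else i,
    by split_ifs <;> omega⟩
  invFun j := ⟨if p ≤ (j : ℕ) ∧ (j : ℕ) < 2 * p then 3 * p - 1 - j else j,
    by split_ifs <;> omega⟩
  left_inv i := by
    ext
    dsimp only
    split_ifs <;> omega
  right_inv j := by
    ext
    dsimp only
    split_ifs <;> omega

/-- A sequence of `k` copies of a gadget with `m` links, one after the other. -/
def repeatPerm (k : ℕ) {m : ℕ} (τ : Equiv.Perm (Fin m)) : Equiv.Perm (Fin (k * m)) :=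
  (finProdFinEquiv : Fin k × Fin m ≃ Fin (k * m)).permCongr ((Equiv.refl (Fin k)).prodCongr τ)

/-- The linking bijections for `l`-ladders between `A` and `B` and between `C` and `A`, and the
gadget `τ` between `B` and `C`. -/
def ladderExcept (τ : Equiv.Perm (Fin l)) : Fin 3 → Equiv.Perm (Fin l) :=
  ![Equiv.refl _, τ, Equiv.refl _]

end Todinca

open Todinca

/-- The linking bijections of `G_{k,p}`. -/
def handleLinks (k p : ℕ) : Fin 3 → Equiv.Perm (Fin (k * (5 * p))) :=
  ladderExcept (repeatPerm k (handlePerm p))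

/-- The linking bijections of the non-orientable analogue of `G_{k,p}`. -/
def crosscapLinks (k p : ℕ) : Fin 3 → Equiv.Perm (Fin (k * (3 * p))) :=
  ladderExcept (repeatPerm k (crosscapPerm p))

/-- The Todinca graph `G_{k,p}`, of order `5kp`. -/
def orientableTodincaGraph (k p : ℕ) : SimpleGraph (Vertex (k * (5 * p))) :=
  graph (handleLinks k p)

/-- The Todinca graph of order `3kp` defined with `p`-crosscaps instead of `p`-handles. -/
def nonorientableTodincaGraph (k p : ℕ) : SimpleGraph (Vertex (k * (3 * p))) :=
  graph (crosscapLinks k p)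

/-- The embedding `Γ_{k,p}` of `G_{k,p}` in the sphere with `k` handles: no edge is twisted. -/
noncomputable def orientableTodincaEmbedding (k p : ℕ) :
    CellularEmbedding (orientableTodincaGraph k p) :=
  embedding (handleLinks k p) fun _ => false

/-- The edges that pass through the crosscaps: the links from `b_i`, where `i` is in the middle
third of the indices of a `p`-crosscap. -/
def crosscapEdges (k p : ℕ) : Set (Sym2 (Vertex (k * (3 * p)))) :=
  {e | ∃ (t : Fin k) (o : Fin (3 * p)), p ≤ (o : ℕ) ∧ (o : ℕ) < 2 * p ∧
    e = s(leftTop 1 (finProdFinEquiv (t, o)),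
      rightTop 2 (crosscapLinks k p 1 (finProdFinEquiv (t, o))))}

open Classical in
/-- The embedding of the non-orientable Todinca graph in the sphere with `k` crosscaps: exactly the
edges that pass through the crosscaps are twisted. -/
noncomputable def nonorientableTodincaEmbedding (k p : ℕ) :
    CellularEmbedding (nonorientableTodincaGraph k p) :=
  embedding (crosscapLinks k p) fun e => decide (e ∈ crosscapEdges k p)

/-! Apart from the squares of the three grids, every face of the embedding lies above some top row;
the outer faces of the grids are among these and are all equal. A tree-decomposition of the dual has
one bag with all these non-cell faces. From it hang three paths, one per grid, whose bags sweep
through the cells row by row, each holding the outer face and a window of consecutive cells. A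
window is just long enough to contain a cell and the cell above it, so the path bags have at most `2
* l + 1` elements. The root bag is the one that matters, and the width is at most the number of
non-cell faces minus one (`treewidth_le_of_three_grids`, `treewidth_dual_le`).

It remains to count the non-cell faces. The gaps above the top rows are identified across the links.
The two ladders and the gadget leave at most `3 * l - 1` classes: `l - 1` in the left half of each
of A and C, and `l + 1` in the right half of C (`encard_topFaces_le`). At the border between two
blocks of a gadget, one gap of B is identified with two different gaps of C. Each handle thereby
makes two gaps of C redundant (`handle_redundant`) and each crosscap one (`crosscap_redundant`),
which gives the terms `2 * k` and `k`.

Faces are equivalence classes of sides of darts, so equalities come from chains of elementary steps.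
That two cells are different faces, and that no cell is a top face, needs an invariant: a map on
faces that returns the cell, obtained from `exists_lift_of_corner`. -/

/-! ### Rooted trees given by a parent map -/

section ParentTree

variable {V : Type}

/-- The graph in which every node other than the root is adjacent to its parent. -/
def parentGraph (root : V) (parent : V → V) : SimpleGraph V :=
  SimpleGraph.fromRel fun x y => x ≠ root ∧ parent x = y

theorem parentGraph_adj_parent {root : V} {parent : V → V} {x : V} (hx : x ≠ root)
    (h : parent x ≠ x) : (parentGraph root parent).Adj x (parent x) := by
  rw [parentGraph, SimpleGraph.fromRel_adj]
  exact ⟨h.symm, Or.inl ⟨hx, rfl⟩⟩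

/-- Climbing to parents from any node of `S` stays in `S` and lowers the rank, so it ends at `top`.
This is the form in which the subtree condition on bags is checked. -/
theorem connected_induce_parentGraph {root : V} {parent : V → V} (rank : V → ℕ)
    (hrank : ∀ x, x ≠ root → rank (parent x) < rank x) {S : Set V} {top : V} (htop : top ∈ S)
    (hS : ∀ x ∈ S, x ≠ top → x ≠ root ∧ parent x ∈ S) :
    ((parentGraph root parent).induce S).Connected := by
  have key : ∀ n, ∀ x (hx : x ∈ S), rank x ≤ n →
      ((parentGraph root parent).induce S).Reachable ⟨x, hx⟩ ⟨top, htop⟩ := by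
    intro n
    induction n with
    | zero =>
      intro x hx hn
      by_cases h : x = top
      · subst h; rfl
      · have := hrank x (hS x hx h).1
        omega
    | succ n ih =>
      intro x hx hn
      by_cases h : x = top
      · subst h; rfl
      · obtain ⟨h1, h2⟩ := hS x hx h
        have h3 := hrank x h1
        have h4 : parent x ≠ x := fun e => by rw [e] at h3; exact lt_irrefl _ h3
        refine SimpleGraph.Reachable.trans (SimpleGraph.Adj.reachable ?_)
          (ih (parent x) h2 (by omega))
        exact parentGraph_adj_parent h1 h4
  exact
    { preconnected := fun x y => (key _ x x.2 le_rfl).trans (key _ y y.2 le_rfl).symm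
      nonempty := ⟨⟨top, htop⟩⟩ }

/-- The graph is connected, and every edge joins a non-root node to its parent, so there are fewer
edges than nodes. -/
theorem isTree_parentGraph [Finite V] {root : V} {parent : V → V} (rank : V → ℕ)
    (hrank : ∀ x, x ≠ root → rank (parent x) < rank x) : (parentGraph root parent).IsTree := by
  have hconn : (parentGraph root parent).Connected := by
    have h := connected_induce_parentGraph (S := Set.univ) (top := root) rank hrank
      (Set.mem_univ _) (fun x _ hx => ⟨hx, Set.mem_univ _⟩)
    exact (SimpleGraph.induceUnivIso _).connected_iff.1 h
  rw [SimpleGraph.isTree_iff_connected_and_card]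
  refine ⟨hconn, le_antisymm ?_ hconn.card_vert_le_card_edgeSet_add_one⟩
  have hne : ∀ x : {x // x ≠ root}, parent x ≠ x := fun x e => by
    have h3 := hrank x x.2
    rw [e] at h3
    exact lt_irrefl _ h3
  let f : {x // x ≠ root} → (parentGraph root parent).edgeSet := fun x =>
    ⟨s((x : V), parent x), parentGraph_adj_parent x.2 (hne x)⟩
  have hf : Function.Surjective f := by
    rintro ⟨e, he⟩
    induction e with
    | _ u v =>
      rw [SimpleGraph.mem_edgeSet, parentGraph, SimpleGraph.fromRel_adj] at he
      obtain ⟨_, ⟨h, rfl⟩ | ⟨h, rfl⟩⟩ := he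
      · exact ⟨⟨u, h⟩, rfl⟩
      · exact ⟨⟨v, h⟩, Subtype.ext Sym2.eq_swap⟩
  have h1 := Nat.card_le_card_of_surjective f hf
  have h2 : Nat.card {x // x ≠ root} < Nat.card V :=
    Finite.card_subtype_lt (p := fun x => x ≠ root) (x := root) (by simp)
  omega

end ParentTree

/-! ### A tree-decomposition that sweeps through three grids -/

section ThreeGrids

/-- The parent of a node of a tree that consists of a root `none` and of three paths of length `N`
that start next to it. -/
def spiderParent {N : ℕ} : Option (Fin 3 × Fin N) → Option (Fin 3 × Fin N)
  | none => none
  | some (g, j) => if (j : ℕ) = 0 then none else some (g, ⟨j - 1, by omega⟩)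

/-- The distance between a node and the root. -/
def spiderRank {N : ℕ} : Option (Fin 3 × Fin N) → ℕ
  | none => 0
  | some (_, j) => j + 1

theorem spiderRank_parent {N : ℕ} (x : Option (Fin 3 × Fin N)) (hx : x ≠ none) :
    spiderRank (spiderParent x) < spiderRank x := by
  obtain _ | ⟨g, j⟩ := x
  · exact absurd rfl hx
  · simp only [spiderParent]
    split_ifs with h
    · simp [spiderRank]
    · simp only [spiderRank]
      omega

variable {α β : Type}

/-- The `i`-th element of the grid `g`, row by row, when rows have length `M`. -/
def rowMajor (M : ℕ) (E : Fin 3 → ℕ → ℕ → α) (g : Fin 3) (i : ℕ) : α := E g (i % M) (i / M)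

theorem rowMajor_eq {M : ℕ} (E : Fin 3 → ℕ → ℕ → α) (g : Fin 3) {c : ℕ} (r : ℕ) (hc : c < M) :
    rowMajor M E g (r * M + c) = E g c r := by
  have h1 : (r * M + c) % M = c := by
    rw [Nat.add_comm, Nat.add_mul_mod_self_right, Nat.mod_eq_of_lt hc]
  have h2 : (r * M + c) / M = r := by
    rw [Nat.add_comm, Nat.add_mul_div_right _ _ (by omega), Nat.div_eq_of_lt hc, Nat.zero_add]
  rw [rowMajor, h1, h2]

/-- Bags for a graph made of three grids and of a set of further vertices, namely those `f` with
`cell f = none`: the root carries the latter and the paths sweep through the grids. -/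
def sweepBag (M : ℕ) (E : Fin 3 → ℕ → ℕ → α) (O : α) (cell : α → Option (Fin 3 × ℕ × ℕ)) :
    Option (Fin 3 × Fin (M * M)) → Set α
  | none => {f | cell f = none}
  | some (g, j) => insert O (rowMajor M E g '' Set.Icc (j : ℕ) (j + M))

/-- Tree-width of a graph whose vertices are the vertices `E g c r`, `0 ≤ c < M`, `1 ≤ r ≤ M`, of
three `M × M` grids, and at most `w + 1` others, if the edges that leave the `g`-th grid lead to
a vertex `O` or from `E g c 1` to `E g c 0`. -/
theorem treewidth_le_of_three_grids {H : Graph α β} {M w : ℕ} {E : Fin 3 → ℕ → ℕ → α} {O : α}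
    {cell : α → Option (Fin 3 × ℕ × ℕ)} (hV : H.vertexSet = Set.univ)
    (hO : cell O = none) (hE0 : ∀ g c, c < M → cell (E g c 0) = none)
    (hE : ∀ g c r, c < M → r < M → cell (E g c (r + 1)) = some (g, c, r + 1))
    (hcell : ∀ f g c r, cell f = some (g, c, r) →
      c < M ∧ 0 < r ∧ r ≤ M ∧ f = E g c r)
    (hlink : ∀ e x y, H.IsLink e x y → (cell x = none ∧ cell y = none) ∨
      ∃ g c r, c < M ∧ r < M ∧ ∃ z, (z = O ∨ z = E g c r ∨ (c + 1 < M ∧ z = E g (c + 1) (r + 1))) ∧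
        ((x = E g c (r + 1) ∧ y = z) ∨ (x = z ∧ y = E g c (r + 1))))
    (hcard : {f | cell f = none}.encard ≤ (w : ℕ∞) + 1) (hw : M + 1 ≤ w) :
    treewidth H ≤ (w : ℕ∞) := by
  have hrow0 : ∀ g i, i < M → cell (rowMajor M E g i) = none := by
    intro g i hi
    have := rowMajor_eq E g 0 hi
    rw [Nat.zero_mul, Nat.zero_add] at this
    rw [this]
    exact hE0 g i hi
  have hrow : ∀ g i, M ≤ i → i < M * M + M →
      cell (rowMajor M E g i) = some (g, i % M, i / M) := by
    intro g i h1 h2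
    have hM : 0 < M := by
      rcases Nat.eq_zero_or_pos M with rfl | h
      · omega
      · exact h
    have h3 : i / M < M + 1 := by
      rw [Nat.div_lt_iff_lt_mul hM, Nat.add_mul, Nat.one_mul]
      exact h2
    have h4 : 1 ≤ i / M := by
      rw [Nat.le_div_iff_mul_le hM, Nat.one_mul]
      exact h1
    have h5 := hE g (i % M) (i / M - 1) (Nat.mod_lt _ hM) (by omega)
    rw [Nat.sub_add_cancel h4] at h5
    exact h5
  have hlt : ∀ j : Fin (M * M), ∀ i ∈ Set.Icc (j : ℕ) (j + M), i < M * M + M := by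
    intro j i hi
    have := hi.2
    omega
  let D : TreeDecomposition H :=
    { Node := Option (Fin 3 × Fin (M * M))
      finite_node := inferInstance
      T := parentGraph none spiderParent
      isTree := isTree_parentGraph spiderRank spiderRank_parent
      bag := sweepBag M E O cell
      bag_subset := fun t => by rw [hV]; exact Set.subset_univ _
      exists_bag_of_isLink := by
        intro e x y h
        rcases hlink e x y h with h | ⟨g, c, r, hc, hr, z, hz, hxy⟩
        · exact ⟨none, h⟩
        suffices hs : ∃ t, E g c (r + 1) ∈ sweepBag M E O cell t ∧ z ∈ sweepBag M E O cell t by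
          obtain ⟨t, h1, h2⟩ := hs
          rcases hxy with ⟨rfl, rfl⟩ | ⟨rfl, rfl⟩
          exacts [⟨t, h1, h2⟩, ⟨t, h2, h1⟩]
        have hj : r * M + M ≤ M * M := by
          have := Nat.mul_le_mul_right M (Nat.succ_le_of_lt hr)
          rwa [Nat.succ_mul] at this
        have e1 := rowMajor_eq E g (r + 1) hc
        rw [Nat.add_mul, Nat.one_mul] at e1
        -- The cell has row-major index `(r + 1) * M + c`. The window that starts at `r * M + c`
        -- ends there, so it contains both the cell and the one above it; shifted by one, the window
        -- also contains the cell to the right.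
        rcases hz with rfl | rfl | ⟨hc', rfl⟩
        · exact ⟨some (g, ⟨r * M + c, by omega⟩),
            Or.inr ⟨_, ⟨by dsimp only; omega, by dsimp only; omega⟩, e1⟩, Or.inl rfl⟩
        · exact ⟨some (g, ⟨r * M + c, by omega⟩),
            Or.inr ⟨_, ⟨by dsimp only; omega, by dsimp only; omega⟩, e1⟩,
            Or.inr ⟨_, ⟨by dsimp only; omega, by dsimp only; omega⟩, rowMajor_eq E g r hc⟩⟩
        · have e2 := rowMajor_eq E g (r + 1) hc'
          rw [Nat.add_mul, Nat.one_mul] at e2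
          exact ⟨some (g, ⟨r * M + (c + 1), by omega⟩),
            Or.inr ⟨_, ⟨by dsimp only; omega, by dsimp only; omega⟩, e1⟩,
            Or.inr ⟨_, ⟨by dsimp only; omega, by dsimp only; omega⟩, e2⟩⟩
      connected_of_mem := by
        intro f _
        rcases hf : cell f with _ | ⟨g, c, r⟩
        -- Such a vertex is in the root bag. On a path it occurs as `O`, which is in all bags, or
        -- with an index `i < M` in row `0`; then every earlier window contains it too.
        · refine connected_induce_parentGraph (top := none) spiderRank spiderRank_parent hf ?_
          rintro (_ | ⟨g, j⟩) hx hne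
          · exact absurd rfl hne
          refine ⟨hne, ?_⟩
          simp only [spiderParent]
          split_ifs with h0
          · exact hf
          · rcases hx with rfl | ⟨i, hi, rfl⟩
            · exact Or.inl rfl
            · have hiM : i < M := by
                by_contra hcon
                rw [hrow g i (by omega) (hlt j i hi)] at hf
                exact absurd hf (by simp)
              have := hi.1
              exact Or.inr ⟨i, ⟨by dsimp only; omega, by dsimp only; omega⟩, rfl⟩
        · obtain ⟨hc, hr0, hrM, rfl⟩ := hcell f g c r hf
          obtain ⟨r, rfl⟩ : ∃ r', r = r' + 1 := ⟨r - 1, by omega⟩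
          have hj : r * M + M ≤ M * M := by
            have := Nat.mul_le_mul_right M hrM
            rwa [Nat.succ_mul] at this
          have e1 := rowMajor_eq E g (r + 1) hc
          rw [Nat.add_mul, Nat.one_mul] at e1
          -- The windows that contain the index `i = (r + 1) * M + c` start between `i - M` and `i`;
          -- the one closest to the root starts at `i - M = r * M + c`.
          refine connected_induce_parentGraph (top := some (g, ⟨r * M + c, by omega⟩))
            spiderRank spiderRank_parent
            (Or.inr ⟨_, ⟨by dsimp only; omega, by dsimp only; omega⟩, e1⟩) ?_
          rintro (_ | ⟨g', j⟩) hx hne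
          · exact absurd (hf.symm.trans hx) (by simp)
          refine ⟨by simp, ?_⟩
          rcases hx with hx | ⟨i, hi, hx⟩
          · rw [hx, hO] at hf
            exact absurd hf (by simp)
          have hiM : M ≤ i := by
            by_contra hcon
            rw [← hx, hrow0 g' i (by omega)] at hf
            exact absurd hf (by simp)
          have h6 := hrow g' i hiM (hlt j i hi)
          rw [hx, hf] at h6
          simp only [Option.some.injEq, Prod.mk.injEq] at h6
          obtain ⟨rfl, h7, h8⟩ := h6
          -- `E` is not assumed injective, but `cell` recovers column and row, hence the index.
          have hi' : i = r * M + M + c := by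
            have h9 := Nat.div_add_mod i M
            rw [← h7, ← h8, Nat.mul_comm, Nat.add_mul, Nat.one_mul] at h9
            exact h9.symm
          have hj1 : (j : ℕ) ≠ r * M + c := by
            intro e
            exact hne (congrArg some (Prod.ext rfl (Fin.ext e)))
          obtain ⟨hi1, hi2⟩ := hi
          have hj0 : (j : ℕ) ≠ 0 := by omega
          simp only [spiderParent, hj0, if_false]
          exact Or.inr ⟨i, ⟨by dsimp only; omega, by dsimp only; omega⟩, hx⟩ }
  refine (iInf_le _ D).trans (iSup_le ?_)
  rintro (_ | ⟨g, j⟩)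
  · exact tsub_le_iff_right.2 hcard
  -- A window has `M + 1` indices and `O` adds one element, so the bag has at most `M + 2 ≤ w + 1`.
  · refine tsub_le_iff_right.2 ((Set.encard_insert_le _ _).trans ?_)
    gcongr
    refine (Set.encard_image_le _ _).trans ?_
    rw [← Finset.coe_Icc, Set.encard_coe_eq_coe_finsetCard, Nat.card_Icc]
    exact_mod_cast (by omega : (j : ℕ) + M + 1 - j ≤ w)

end ThreeGrids

/-! ### Faces described by the angles at the vertices -/

namespace Todinca

variable {l : ℕ}

/-- The direction itself if it is present, and otherwise the last one before it that is. -/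
def lastDir (P : Fin 4 → Bool) (d : Fin 4) : Fin 4 := if P d then d else prevDir P d

theorem lastDir_present : ∀ (P : Fin 4 → Bool) (d : Fin 4), P 0 = true →
    P (lastDir P d) = true := by decide

theorem lastDir_of_present (P : Fin 4 → Bool) (d : Fin 4) (h : P d = true) : lastDir P d = d := by
  simp [lastDir, h]

theorem nextDir_lastDir_sub_one : ∀ (P : Fin 4 → Bool) (d : Fin 4), P d = true →
    nextDir P (lastDir P (d - 1)) = d := by decide

theorem lastDir_nextDir_sub_one : ∀ (P : Fin 4 → Bool) (d : Fin 4), P d = true →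
    lastDir P (nextDir P d - 1) = d := by decide

theorem lastDir_add_one_of_absent : ∀ (P : Fin 4 → Bool) (d : Fin 4), P 0 = true →
    P (d + 1) = false → lastDir P (d + 1) = lastDir P d := by decide

/-- Angles separated only by absent directions are one corner of the embedding. Starting from
direction `0`, which is present, the equality propagates once around the vertex. -/
theorem apply_lastDir {Y : Type} {P : Fin 4 → Bool} (h0 : P 0 = true) {I : Fin 4 → Y}
    (hI : ∀ k, P (k + 1) = false → I (k + 1) = I k) (k : Fin 4) : I (lastDir P k) = I k := by
  have step : ∀ k, I (lastDir P k) = I k → I (lastDir P (k + 1)) = I (k + 1) := by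
    intro k h
    cases hP : P (k + 1) with
    | true => rw [lastDir_of_present P _ hP]
    | false => rw [lastDir_add_one_of_absent P k h0 hP, h, hI k hP]
  have h0' : I (lastDir P 0) = I 0 := by rw [lastDir_of_present P 0 h0]
  have h1 := step 0 h0'
  have h2 := step 1 h1
  have h3 := step 2 h2
  fin_cases k
  exacts [h0', h1, h2, h3]

variable (σ : Fin 3 → Equiv.Perm (Fin l)) (twist : Sym2 (Vertex l) → Bool)

/-- The directions in which a vertex has a neighbour. -/
def present (v : Vertex l) (d : Fin 4) : Bool := (neighbour σ v d).isSome

/-- The dart that leaves a vertex in a direction that is present. -/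
noncomputable def dirDart (v : Vertex l) (d : Fin 4) (h : present σ v d = true) :
    (graph σ).Dart := portEquivDart σ ⟨(v, d), h⟩

/-- The face of the embedding at the angle between the directions `k` and `k + 1` at `v`. -/
noncomputable def corner (v : Vertex l) (k : Fin 4) : (embedding σ twist).Face :=
  (embedding σ twist).face (dirDart σ v (lastDir (present σ v) k)
    (lastDir_present _ k (neighbour_up_isSome σ v)), true)

variable {σ twist}

theorem neighbour_eq_dirDart_snd {v : Vertex l} {d : Fin 4} (h : present σ v d = true) :
    neighbour σ v d = some (dirDart σ v d h).snd := (Option.some_get h).symm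

theorem dirDart_congr {v : Vertex l} {d d' : Fin 4} (e : d = d') (h : present σ v d = true) :
    dirDart σ v d h = dirDart σ v d' (e ▸ h) := by
  subst e; rfl

theorem exists_eq_dirDart (a : (graph σ).Dart) : ∃ v d h, a = dirDart σ v d h := by
  obtain ⟨⟨⟨v, d⟩, h⟩, rfl⟩ := (portEquivDart σ).surjective a
  exact ⟨v, d, h, rfl⟩

theorem rot_dirDart {v : Vertex l} {d : Fin 4} (h : present σ v d = true) :
    (embedding σ twist).rot (dirDart σ v d h) =
      dirDart σ v (nextDir (present σ v) d) (nextDir_present _ _ h) := by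
  change (portEquivDart σ).permCongr (portRot σ) (portEquivDart σ _) = _
  rw [Equiv.permCongr_apply, Equiv.symm_apply_apply]
  rfl

theorem present_of_neighbour {v w : Vertex l} {d : Fin 4} (h : neighbour σ v d = some w) :
    present σ v d = true := by
  simp [present, h]

theorem dirDart_symm {v w : Vertex l} {d d' : Fin 4} (h : neighbour σ v d = some w)
    (h' : neighbour σ w d' = some v) :
    (dirDart σ v d (present_of_neighbour h)).symm = dirDart σ w d' (present_of_neighbour h') := by
  have h1 := neighbour_eq_dirDart_snd (present_of_neighbour h)
  have h2 := neighbour_eq_dirDart_snd (present_of_neighbour h')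
  rw [h, Option.some_inj] at h1
  rw [h', Option.some_inj] at h2
  exact SimpleGraph.Dart.ext _ _ (Prod.ext h1.symm h2)

theorem dirDart_edge {v w : Vertex l} {d : Fin 4} (h : neighbour σ v d = some w) :
    (dirDart σ v d (present_of_neighbour h)).edge = s(v, w) := by
  have h1 := neighbour_eq_dirDart_snd (present_of_neighbour h)
  rw [h, Option.some_inj] at h1
  exact congrArg (fun x => s(v, x)) h1.symm

theorem face_true {v : Vertex l} {d : Fin 4} (h : present σ v d = true) :
    (embedding σ twist).face (dirDart σ v d h, true) = corner σ twist v d := by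
  rw [corner, dirDart_congr (lastDir_of_present _ d h)]

/-- The rotation takes the last present direction up to `d - 1` to `d`, so the side of `d` turned
away from its successor bounds the angle before `d`. -/
theorem face_false {v : Vertex l} {d : Fin 4} (h : present σ v d = true) :
    (embedding σ twist).face (dirDart σ v d h, false) = corner σ twist v (d - 1) := by
  have h0 := lastDir_present (present σ v) (d - 1) (neighbour_up_isSome σ v)
  have h1 := Quot.sound (CellularEmbedding.FaceStep.corner (Γ := embedding σ twist)
    (dirDart σ v (lastDir (present σ v) (d - 1)) h0))
  rw [rot_dirDart, dirDart_congr (nextDir_lastDir_sub_one _ d h)] at h1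
  exact h1.symm

theorem exists_eq_corner (f : (embedding σ twist).Face) : ∃ v k, f = corner σ twist v k := by
  obtain ⟨⟨a, s⟩, rfl⟩ := Quot.exists_rep f
  obtain ⟨v, d, h, rfl⟩ := exists_eq_dirDart a
  cases s
  · exact ⟨v, d - 1, face_false h⟩
  · exact ⟨v, d, face_true h⟩

theorem corner_add_one_of_absent {v : Vertex l} {k : Fin 4} (h : neighbour σ v (k + 1) = none) :
    corner σ twist v (k + 1) = corner σ twist v k := by
  have h1 := lastDir_add_one_of_absent (present σ v) k (neighbour_up_isSome σ v)
    (by simp [present, h])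
  rw [corner, dirDart_congr h1]
  rfl

/-- With agreeing orientations, the side that follows the edge in the rotation at one end precedes
it at the other. -/
theorem corner_along {v w : Vertex l} {d d' : Fin 4} (h : neighbour σ v d = some w)
    (h' : neighbour σ w d' = some v) (ht : twist s(v, w) = false) :
    corner σ twist v d = corner σ twist w (d' - 1) := by
  have h1 := (embedding σ twist).face_symm (dirDart σ v d (present_of_neighbour h)) false
  rw [dirDart_symm h h', dirDart_edge h, face_false] at h1
  change _ = (embedding σ twist).face (_, xor (!false) (twist s(v, w))) at h1
  rw [ht] at h1
  exact (face_true _).symm.trans h1.symm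

/-- The orientations at the two ends disagree, so a side that follows the edge at one end also
follows it at the other. -/
theorem corner_along_twisted {v w : Vertex l} {d d' : Fin 4} (h : neighbour σ v d = some w)
    (h' : neighbour σ w d' = some v) (ht : twist s(v, w) = true) :
    corner σ twist v d = corner σ twist w d' ∧
      corner σ twist v (d - 1) = corner σ twist w (d' - 1) := by
  have h1 := (embedding σ twist).face_symm (dirDart σ v d (present_of_neighbour h)) true
  have h2 := (embedding σ twist).face_symm (dirDart σ v d (present_of_neighbour h)) false
  rw [dirDart_symm h h', dirDart_edge h] at h1 h2
  rw [face_true] at h1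
  rw [face_false] at h2
  change _ = (embedding σ twist).face (_, xor (!true) (twist s(v, w))) at h1
  change _ = (embedding σ twist).face (_, xor (!false) (twist s(v, w))) at h2
  rw [ht] at h1 h2
  exact ⟨(face_true _).symm.trans h1.symm, (face_false _).symm.trans h2.symm⟩

/-- A function of the angles that agrees wherever two angles belong to the same face for an
elementary reason is a function of the faces. -/
theorem exists_lift_of_corner {Y : Type} (I : Vertex l → Fin 4 → Y)
    (habs : ∀ v k, neighbour σ v (k + 1) = none → I v (k + 1) = I v k)
    (halong : ∀ v w d d', neighbour σ v d = some w → neighbour σ w d' = some v →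
      twist s(v, w) = false → I v d = I w (d' - 1))
    (htwisted : ∀ v w d d', neighbour σ v d = some w → neighbour σ w d' = some v →
      twist s(v, w) = true → I v d = I w d' ∧ I v (d - 1) = I w (d' - 1)) :
    ∃ φ : (embedding σ twist).Face → Y, ∀ v k, φ (corner σ twist v k) = I v k := by
  have hlast : ∀ v k, I v (lastDir (present σ v) k) = I v k := fun v k =>
    apply_lastDir (neighbour_up_isSome σ v)
      (fun k h => habs v k (by simpa [present] using h)) k
  -- As in `face_true` and `face_false`, the two sides of a dart in direction `d` are read as the
  -- angles `d` and `d - 1`.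
  let J : (graph σ).Dart × Bool → Y := fun x =>
    I ((portEquivDart σ).symm x.1).1.1
      (if x.2 then ((portEquivDart σ).symm x.1).1.2 else ((portEquivDart σ).symm x.1).1.2 - 1)
  have hJ : ∀ v d h s, J (dirDart σ v d h, s) = I v (if s then d else d - 1) := by
    intro v d h s
    simp only [J, dirDart, Equiv.symm_apply_apply]
  have hstep : ∀ x y, (embedding σ twist).FaceStep x y → J x = J y := by
    rintro _ _ (⟨a⟩ | ⟨a, s⟩)
    · obtain ⟨v, d, h, rfl⟩ := exists_eq_dirDart a
      rw [rot_dirDart, hJ, hJ]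
      have h1 := hlast v (nextDir (present σ v) d - 1)
      rw [lastDir_nextDir_sub_one _ d h] at h1
      exact h1
    · obtain ⟨v, d, h, rfl⟩ := exists_eq_dirDart a
      have h1 := neighbour_eq_dirDart_snd h
      obtain ⟨d', h2⟩ := exists_neighbour_of_adj (dirDart σ v d h).adj.symm
      change neighbour σ _ d' = some v at h2
      generalize (dirDart σ v d h).snd = w at h1 h2
      rw [dirDart_symm h1 h2, dirDart_edge h1, hJ, hJ]
      change _ = I w (if xor (!s) (twist s(v, w)) then d' else d' - 1)
      cases ht : twist s(v, w)
      · have h3 := halong v w d d' h1 h2 ht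
        have h4 := halong w v d' d h2 h1 (by rw [Sym2.eq_swap]; exact ht)
        cases s
        · simpa using h4.symm
        · simpa using h3
      · have h3 := htwisted v w d d' h1 h2 ht
        cases s
        · simpa using h3.2
        · simpa using h3.1
  refine ⟨Quot.lift J hstep, fun v k => ?_⟩
  change J _ = _
  rw [hJ]
  exact hlast v k

theorem exists_corner_of_isLink {e : Sym2 (Vertex l)} {f g : (embedding σ twist).Face}
    (h : (embedding σ twist).dual.IsLink e f g) :
    ∃ v d, (neighbour σ v d).isSome = true ∧
      ((f = corner σ twist v d ∧ g = corner σ twist v (d - 1)) ∨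
        (f = corner σ twist v (d - 1) ∧ g = corner σ twist v d)) := by
  obtain ⟨a, s, -, rfl, rfl⟩ := h
  obtain ⟨v, d, h, rfl⟩ := exists_eq_dirDart a
  refine ⟨v, d, h, ?_⟩
  cases s
  · exact Or.inr ⟨face_false h, face_true h⟩
  · exact Or.inl ⟨face_true h, face_false h⟩

end Todinca

/-! ### Coordinates and the cell of an angle -/

namespace Todinca

variable {l : ℕ}

/-- The vertex in column `c` and row `r` of the grid `g`, where coordinates that are too large are
replaced by the largest possible ones. -/
def gridVertex (hl : 0 < l) (g : Fin 3) (c r : ℕ) : Vertex l :=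
  (g, ⟨min c (2 * l - 1), by omega⟩, ⟨min r (2 * l - 1), by omega⟩)

theorem eq_gridVertex (hl : 0 < l) (v : Vertex l) : v = gridVertex hl v.1 v.2.1 v.2.2 := by
  refine Prod.ext rfl (Prod.ext (Fin.ext ?_) (Fin.ext ?_))
  · simp only [gridVertex]; omega
  · simp only [gridVertex]; omega

section neighbours

variable (σ : Fin 3 → Equiv.Perm (Fin l)) (hl : 0 < l) (g : Fin 3) {c r : ℕ}

theorem neighbour_right (hc : c + 1 < 2 * l) :
    neighbour σ (gridVertex hl g c r) 3 = some (gridVertex hl g (c + 1) r) := by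
  have h : min c (2 * l - 1) + 1 < 2 * l := by omega
  exact (dif_pos h).trans (congrArg some (Prod.ext rfl (Prod.ext
    (Fin.ext (by simp only [gridVertex]; omega)) rfl)))

theorem neighbour_left (hc : c + 1 < 2 * l) :
    neighbour σ (gridVertex hl g (c + 1) r) 1 = some (gridVertex hl g c r) := by
  have h : 0 < min (c + 1) (2 * l - 1) := by omega
  exact (if_pos h).trans (congrArg some (Prod.ext rfl (Prod.ext
    (Fin.ext (by simp only [gridVertex]; omega)) rfl)))

theorem neighbour_down (hr : r + 1 < 2 * l) :
    neighbour σ (gridVertex hl g c r) 2 = some (gridVertex hl g c (r + 1)) := by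
  have h : min r (2 * l - 1) + 1 < 2 * l := by omega
  exact (dif_pos h).trans (congrArg some (Prod.ext rfl (Prod.ext rfl
    (Fin.ext (by simp only [gridVertex]; omega)))))

theorem neighbour_up (hr : r + 1 < 2 * l) :
    neighbour σ (gridVertex hl g c (r + 1)) 0 = some (gridVertex hl g c r) := by
  have h : 0 < min (r + 1) (2 * l - 1) := by omega
  exact (if_pos h).trans (congrArg some (Prod.ext rfl (Prod.ext rfl
    (Fin.ext (by simp only [gridVertex]; omega)))))

theorem neighbour_left_eq_none : neighbour σ (gridVertex hl g 0 r) 1 = none := by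
  simp [neighbour, gridVertex]

theorem neighbour_down_eq_none : neighbour σ (gridVertex hl g c (2 * l - 1)) 2 = none := by
  have h : ¬ (min (2 * l - 1) (2 * l - 1) + 1 < 2 * l) := by omega
  exact dif_neg h

theorem neighbour_right_eq_none : neighbour σ (gridVertex hl g (2 * l - 1) r) 3 = none := by
  have h : ¬ (min (2 * l - 1) (2 * l - 1) + 1 < 2 * l) := by omega
  exact dif_neg h

theorem neighbour_leftTop (i : Fin l) :
    neighbour σ (leftTop g i) 0 = some (rightTop (g + 1) (σ g i)) := by
  obtain ⟨h1, h2⟩ := link_topNeighbour (σ := σ) (Or.inl ⟨g, i, rfl, rfl⟩)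
  simp only [neighbour, h1, h2]
  rfl

theorem neighbour_rightTop (i : Fin l) :
    neighbour σ (rightTop (g + 1) (σ g i)) 0 = some (leftTop g i) := by
  obtain ⟨h1, h2⟩ := link_topNeighbour (σ := σ) (Or.inr ⟨g, i, rfl, rfl⟩)
  simp only [neighbour, h1, h2]
  rfl

end neighbours

theorem neighbour_spec {σ : Fin 3 → Equiv.Perm (Fin l)} {v w : Vertex l} {d : Fin 4}
    (h : neighbour σ v d = some w) :
    (d = 0 ∧ (v.2.2 : ℕ) = 0 ∧ (w.2.2 : ℕ) = 0 ∧ w.1 ≠ v.1) ∨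
    (d = 0 ∧ w.1 = v.1 ∧ (w.2.1 : ℕ) = v.2.1 ∧ (w.2.2 : ℕ) + 1 = v.2.2) ∨
    (d = 1 ∧ w.1 = v.1 ∧ (w.2.1 : ℕ) + 1 = v.2.1 ∧ (w.2.2 : ℕ) = v.2.2) ∨
    (d = 2 ∧ w.1 = v.1 ∧ (w.2.1 : ℕ) = v.2.1 ∧ (w.2.2 : ℕ) = v.2.2 + 1) ∨
    (d = 3 ∧ w.1 = v.1 ∧ (w.2.1 : ℕ) = v.2.1 + 1 ∧ (w.2.2 : ℕ) = v.2.2) := by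
  fin_cases d
  · simp only [neighbour] at h
    split_ifs at h with h1
    · obtain rfl := Option.some.inj h
      refine Or.inr (Or.inl ⟨rfl, rfl, rfl, ?_⟩)
      dsimp only
      omega
    · obtain rfl := Option.some.inj h
      refine Or.inl ⟨rfl, by omega, ?_, topNeighbour_fst_ne σ _ _⟩
      rw [topNeighbour]
      split_ifs <;> rfl
  · simp only [neighbour] at h
    split_ifs at h with h1
    obtain rfl := Option.some.inj h
    refine Or.inr (Or.inr (Or.inl ⟨rfl, rfl, ?_, rfl⟩))
    dsimp only
    omega
  · simp only [neighbour] at h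
    split_ifs at h with h1
    obtain rfl := Option.some.inj h
    exact Or.inr (Or.inr (Or.inr (Or.inl ⟨rfl, rfl, rfl, rfl⟩)))
  · simp only [neighbour] at h
    split_ifs at h with h1
    obtain rfl := Option.some.inj h
    exact Or.inr (Or.inr (Or.inr (Or.inr ⟨rfl, rfl, rfl, rfl⟩)))

/-- The grid cell in which an angle lies, if there is one; the cell between the columns `c` and
`c + 1` and the rows `r` and `r + 1` of the grid `g` is `(g, c, r + 1)`. -/
def cornerCell (v : Vertex l) (k : Fin 4) : Option (Fin 3 × ℕ × ℕ) :=
  match k with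
  | 0 => if 0 < (v.2.1 : ℕ) ∧ 0 < (v.2.2 : ℕ) then some (v.1, v.2.1 - 1, v.2.2) else none
  | 1 => if 0 < (v.2.1 : ℕ) ∧ (v.2.2 : ℕ) + 1 < 2 * l then some (v.1, v.2.1 - 1, v.2.2 + 1)
    else none
  | 2 => if (v.2.1 : ℕ) + 1 < 2 * l ∧ (v.2.2 : ℕ) + 1 < 2 * l then some (v.1, v.2.1, v.2.2 + 1)
    else none
  | 3 => if (v.2.1 : ℕ) + 1 < 2 * l ∧ 0 < (v.2.2 : ℕ) then some (v.1, v.2.1, v.2.2) else none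

theorem cornerCell_of_absent {σ : Fin 3 → Equiv.Perm (Fin l)} {v : Vertex l} {k : Fin 4}
    (h : neighbour σ v (k + 1) = none) : cornerCell v (k + 1) = cornerCell v k := by
  fin_cases k
  · change neighbour σ v 1 = none at h
    change cornerCell v 1 = cornerCell v 0
    simp only [neighbour, ite_eq_right_iff, reduceCtorEq, imp_false] at h
    simp [cornerCell, h]
  · change neighbour σ v 2 = none at h
    change cornerCell v 2 = cornerCell v 1
    simp only [neighbour, dite_eq_right_iff, reduceCtorEq, imp_false] at h
    simp [cornerCell, h]
  · change neighbour σ v 3 = none at h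
    change cornerCell v 3 = cornerCell v 2
    simp only [neighbour, dite_eq_right_iff, reduceCtorEq, imp_false] at h
    simp [cornerCell, h]
  · have := neighbour_up_isSome σ v
    change neighbour σ v 0 = none at h
    simp [h] at this

/-- Only opposite directions inside a grid, or up at both ends of a link, are consistent. In the
first case both angles are on the same side of a grid edge; in the second both lie above top rows
and have no cell. -/
theorem cornerCell_along {σ : Fin 3 → Equiv.Perm (Fin l)} {v w : Vertex l} {d d' : Fin 4}
    (h : neighbour σ v d = some w) (h' : neighbour σ w d' = some v) :
    cornerCell v d = cornerCell w (d' - 1) := by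
  obtain ⟨g, ⟨c, hc⟩, ⟨r, hr⟩⟩ := v
  obtain ⟨g', ⟨c', hc'⟩, ⟨r', hr'⟩⟩ := w
  have h1 := neighbour_spec h
  have h2 := neighbour_spec h'
  dsimp only at h1 h2
  rcases h1 with ⟨rfl, a1, a2, a3⟩ | ⟨rfl, a1, a2, a3⟩ | ⟨rfl, a1, a2, a3⟩ | ⟨rfl, a1, a2, a3⟩ |
      ⟨rfl, a1, a2, a3⟩ <;>
    rcases h2 with ⟨rfl, b1, b2, b3⟩ | ⟨rfl, b1, b2, b3⟩ | ⟨rfl, b1, b2, b3⟩ |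
      ⟨rfl, b1, b2, b3⟩ | ⟨rfl, b1, b2, b3⟩ <;>
    first
      | (exfalso; omega)
      | (first
          | change cornerCell _ 0 = cornerCell _ 1
          | change cornerCell _ 1 = cornerCell _ 2
          | change cornerCell _ 2 = cornerCell _ 3
          | change cornerCell _ 3 = cornerCell _ 0
         subst a1
         simp only [cornerCell]
         split_ifs <;> first
           | rfl
           | (exfalso; omega)
           | (simp only [Option.some_inj, Prod.mk.injEq, true_and]; omega))
      | (change cornerCell _ 0 = cornerCell _ 3
         simp [cornerCell, a1, a2])

/-- An edge between different grids leaves a top row upwards, and no cell lies above that row. Hence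
twisted links cannot disturb the cell invariant. -/
theorem cornerCell_of_link {σ : Fin 3 → Equiv.Perm (Fin l)} {v w : Vertex l} {d : Fin 4}
    (h : neighbour σ v d = some w) (hne : v.1 ≠ w.1) :
    cornerCell v d = none ∧ cornerCell v (d - 1) = none := by
  rcases neighbour_spec h with ⟨rfl, a1, a2, a3⟩ | ⟨rfl, a1, a2, a3⟩ | ⟨rfl, a1, a2, a3⟩ |
      ⟨rfl, a1, a2, a3⟩ | ⟨rfl, a1, a2, a3⟩
  · change cornerCell v 0 = none ∧ cornerCell v 3 = none
    simp [cornerCell, a1]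
  all_goals exact absurd a1.symm hne

end Todinca

/-! ### The non-cell faces and the tree-width of the dual -/

namespace Todinca

variable {l : ℕ}

section faces

variable (σ : Fin 3 → Equiv.Perm (Fin l)) (twist : Sym2 (Vertex l) → Bool) (hl : 0 < l)

/-- The face at an angle of a grid vertex that is given by its coordinates. -/
noncomputable def gridCorner (g : Fin 3) (c r : ℕ) (k : Fin 4) : (embedding σ twist).Face :=
  corner σ twist (gridVertex hl g c r) k

/-- The face between the columns `j - 1` and `j`, above the top row of the grid `g`. -/
noncomputable def topFace (g : Fin 3) (j : ℕ) : (embedding σ twist).Face :=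
  if j < 2 * l then gridCorner σ twist hl g j 0 0 else gridCorner σ twist hl g (2 * l - 1) 0 3

variable {σ twist hl}

theorem topFace_of_lt {g : Fin 3} {j : ℕ} (h : j < 2 * l) :
    topFace σ twist hl g j = gridCorner σ twist hl g j 0 0 := if_pos h

theorem cornerCell_gridVertex_zero {g : Fin 3} {c r : ℕ} (hc : c + 1 < 2 * l) (hr : r + 1 < 2 * l) :
    cornerCell (gridVertex hl g (c + 1) (r + 1)) 0 = some (g, c, r + 1) := by
  have h1 : min (c + 1) (2 * l - 1) = c + 1 := by omega
  have h2 : min (r + 1) (2 * l - 1) = r + 1 := by omega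
  simp [cornerCell, gridVertex, h1, h2]

theorem cornerCell_gridVertex_top (g : Fin 3) (c : ℕ) :
    cornerCell (gridVertex hl g c 0) 0 = none := by
  simp [cornerCell, gridVertex]

theorem gridCorner_left_border (g : Fin 3) (r : ℕ) :
    gridCorner σ twist hl g 0 r 1 = gridCorner σ twist hl g 0 r 0 :=
  corner_add_one_of_absent (k := 0) (neighbour_left_eq_none σ hl g)

theorem gridCorner_bottom_border (g : Fin 3) (c : ℕ) :
    gridCorner σ twist hl g c (2 * l - 1) 2 = gridCorner σ twist hl g c (2 * l - 1) 1 :=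
  corner_add_one_of_absent (k := 1) (neighbour_down_eq_none σ hl g)

theorem gridCorner_right_border (g : Fin 3) (r : ℕ) :
    gridCorner σ twist hl g (2 * l - 1) r 3 = gridCorner σ twist hl g (2 * l - 1) r 2 :=
  corner_add_one_of_absent (k := 2) (neighbour_right_eq_none σ hl g)

variable (g : Fin 3) {c r : ℕ}

theorem gridCorner_right_up (htwist : ∀ u v : Vertex l, u.1 = v.1 → twist s(u, v) = false)
    (hc : c + 1 < 2 * l) :
    gridCorner σ twist hl g c r 3 = gridCorner σ twist hl g (c + 1) r 0 :=
  corner_along (neighbour_right σ hl g hc) (neighbour_left σ hl g hc) (htwist _ _ rfl)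

theorem gridCorner_right_down (htwist : ∀ u v : Vertex l, u.1 = v.1 → twist s(u, v) = false)
    (hc : c + 1 < 2 * l) :
    gridCorner σ twist hl g c r 2 = gridCorner σ twist hl g (c + 1) r 1 :=
  (corner_along (neighbour_left σ hl g hc) (neighbour_right σ hl g hc) (htwist _ _ rfl)).symm

theorem gridCorner_down_left (htwist : ∀ u v : Vertex l, u.1 = v.1 → twist s(u, v) = false)
    (hr : r + 1 < 2 * l) :
    gridCorner σ twist hl g c r 1 = gridCorner σ twist hl g c (r + 1) 0 :=
  (corner_along (neighbour_up σ hl g hr) (neighbour_down σ hl g hr) (htwist _ _ rfl)).symm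

theorem gridCorner_down_right (htwist : ∀ u v : Vertex l, u.1 = v.1 → twist s(u, v) = false)
    (hr : r + 1 < 2 * l) :
    gridCorner σ twist hl g c r 2 = gridCorner σ twist hl g c (r + 1) 3 :=
  corner_along (neighbour_down σ hl g hr) (neighbour_up σ hl g hr) (htwist _ _ rfl)

/-- Here and in the next lemmas the outer face is followed around the grid: down the left side,
along the bottom and up the right side. At each border vertex the absent direction merges two
angles, and a border edge leads to the next vertex. -/
theorem gridCorner_left_eq_topFace (htwist : ∀ u v : Vertex l, u.1 = v.1 → twist s(u, v) = false)
    (hr : r < 2 * l) : gridCorner σ twist hl g 0 r 0 = topFace σ twist hl g 0 := by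
  induction r with
  | zero => rw [topFace_of_lt (by omega)]
  | succ r ih =>
    rw [← gridCorner_down_left g htwist hr, gridCorner_left_border]
    exact ih (by omega)

theorem gridCorner_bottom_eq_topFace (htwist : ∀ u v : Vertex l, u.1 = v.1 → twist s(u, v) = false)
    (hc : c < 2 * l) : gridCorner σ twist hl g c (2 * l - 1) 1 = topFace σ twist hl g 0 := by
  induction c with
  | zero => rw [gridCorner_left_border, gridCorner_left_eq_topFace g htwist (by omega)]
  | succ c ih =>
    rw [← gridCorner_right_down g htwist hc, gridCorner_bottom_border]
    exact ih (by omega)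

theorem gridCorner_right_eq_topFace (htwist : ∀ u v : Vertex l, u.1 = v.1 → twist s(u, v) = false)
    (hr : r < 2 * l) : gridCorner σ twist hl g (2 * l - 1) r 3 = topFace σ twist hl g 0 := by
  -- The right side is climbed from the bottom, so the induction is on the distance `n` from the
  -- bottom row.
  suffices h : ∀ n, n < 2 * l →
      gridCorner σ twist hl g (2 * l - 1) (2 * l - 1 - n) 3 = topFace σ twist hl g 0 by
    have := h (2 * l - 1 - r) (by omega)
    rwa [show 2 * l - 1 - (2 * l - 1 - r) = r by omega] at this
  intro n hn
  induction n with
  | zero =>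
    rw [Nat.sub_zero, gridCorner_right_border, gridCorner_bottom_border]
    exact gridCorner_bottom_eq_topFace g htwist (by omega)
  | succ n ih =>
    rw [gridCorner_right_border, gridCorner_down_right g htwist (by omega),
      show 2 * l - 1 - (n + 1) + 1 = 2 * l - 1 - n by omega]
    exact ih (by omega)

theorem topFace_last (htwist : ∀ u v : Vertex l, u.1 = v.1 → twist s(u, v) = false) :
    topFace σ twist hl g (2 * l) = topFace σ twist hl g 0 := by
  rw [topFace, if_neg (lt_irrefl _), gridCorner_right_eq_topFace g htwist (by omega)]

theorem gridCorner_three_top (htwist : ∀ u v : Vertex l, u.1 = v.1 → twist s(u, v) = false)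
    (hc : c < 2 * l) : gridCorner σ twist hl g c 0 3 = topFace σ twist hl g (c + 1) := by
  by_cases h : c + 1 < 2 * l
  · rw [topFace_of_lt h, gridCorner_right_up g htwist h]
  · obtain rfl : c = 2 * l - 1 := by omega
    rw [topFace, if_neg h]

/-- Every angle can be slid along grid edges to an upper left angle, unless it reaches the border
and hence the outer face. This gives each face a name in terms of coordinates. -/
theorem eq_topFace_or_eq_gridCorner
    (htwist : ∀ u v : Vertex l, u.1 = v.1 → twist s(u, v) = false)
    (f : (embedding σ twist).Face) : ∃ g, f = topFace σ twist hl g 0 ∨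
      ∃ c r, c + 1 < 2 * l ∧ r < 2 * l ∧ f = gridCorner σ twist hl g (c + 1) r 0 := by
  obtain ⟨v, k, rfl⟩ := exists_eq_corner f
  have h0 : ∀ g c r, c < 2 * l → r < 2 * l →
      ∃ g', gridCorner σ twist hl g c r 0 = topFace σ twist hl g' 0 ∨
        ∃ c' r', c' + 1 < 2 * l ∧ r' < 2 * l ∧
          gridCorner σ twist hl g c r 0 = gridCorner σ twist hl g' (c' + 1) r' 0 := by
    intro g c r hc hr
    refine ⟨g, ?_⟩
    rcases c with _ | c
    · exact Or.inl (gridCorner_left_eq_topFace g htwist hr)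
    · exact Or.inr ⟨c, r, hc, hr, rfl⟩
  have h3 : ∀ g c r, c < 2 * l → r < 2 * l →
      ∃ g', gridCorner σ twist hl g c r 3 = topFace σ twist hl g' 0 ∨
        ∃ c' r', c' + 1 < 2 * l ∧ r' < 2 * l ∧
          gridCorner σ twist hl g c r 3 = gridCorner σ twist hl g' (c' + 1) r' 0 := by
    intro g c r hc hr
    by_cases h : c + 1 < 2 * l
    · exact ⟨g, Or.inr ⟨c, r, h, hr, gridCorner_right_up g htwist h⟩⟩
    · obtain rfl : c = 2 * l - 1 := by omega
      exact ⟨g, Or.inl (gridCorner_right_eq_topFace g htwist hr)⟩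
  obtain ⟨g, ⟨c, hc⟩, ⟨r, hr⟩⟩ := v
  have hv : corner σ twist (g, ⟨c, hc⟩, ⟨r, hr⟩) k = gridCorner σ twist hl g c r k := by
    rw [gridCorner, ← eq_gridVertex hl (g, ⟨c, hc⟩, ⟨r, hr⟩)]
  rw [hv]
  have hk : ∀ k : Fin 4, k = 0 ∨ k = 1 ∨ k = 2 ∨ k = 3 := by decide
  by_cases hr' : r + 1 < 2 * l
  · rcases hk k with rfl | rfl | rfl | rfl
    · exact h0 g c r hc hr
    · rw [gridCorner_down_left g htwist hr']
      exact h0 g c (r + 1) hc hr'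
    · rw [gridCorner_down_right g htwist hr']
      exact h3 g c (r + 1) hc hr'
    · exact h3 g c r hc hr
  · obtain rfl : r = 2 * l - 1 := by omega
    rcases hk k with rfl | rfl | rfl | rfl
    · exact h0 g c _ hc hr
    · exact ⟨g, Or.inl (gridCorner_bottom_eq_topFace g htwist hc)⟩
    · rw [gridCorner_bottom_border]
      exact ⟨g, Or.inl (gridCorner_bottom_eq_topFace g htwist hc)⟩
    · exact h3 g c _ hc hr

/-- The set of the faces that lie above a top row. -/
def topFaces (σ : Fin 3 → Equiv.Perm (Fin l)) (twist : Sym2 (Vertex l) → Bool) (hl : 0 < l) :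
    Set (embedding σ twist).Face := {f | ∃ g j, j ≤ 2 * l ∧ f = topFace σ twist hl g j}

/-- If all the outer faces of the grids are the same one, then the tree-width of the dual is less
than the number of faces that are not grid cells. -/
theorem treewidth_dual_le (htwist : ∀ u v : Vertex l, u.1 = v.1 → twist s(u, v) = false) {w : ℕ}
    (houter : ∀ g, topFace σ twist hl g 0 = topFace σ twist hl 0 0)
    (hcard : (topFaces σ twist hl).encard ≤ (w : ℕ∞) + 1) (hw : 2 * l ≤ w) :
    treewidth (embedding σ twist).dual ≤ (w : ℕ∞) := by
  -- `φ` reads the cell off a face, so different cells are different faces and none of them is a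
  -- face above a top row.
  obtain ⟨φ, hφ⟩ := exists_lift_of_corner (σ := σ) (twist := twist) cornerCell
    (fun _ _ => cornerCell_of_absent) (fun _ _ _ _ h h' _ => cornerCell_along h h')
    (fun v w d d' h h' ht => by
      have hne : v.1 ≠ w.1 := fun e => by rw [htwist v w e] at ht; exact absurd ht (by simp)
      have h1 := cornerCell_of_link h hne
      have h2 := cornerCell_of_link h' hne.symm
      rw [h1.1, h1.2, h2.1, h2.2]
      exact ⟨rfl, rfl⟩)
  have hφtop : ∀ g, φ (topFace σ twist hl g 0) = none := fun g => by
    rw [topFace_of_lt (by omega)]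
    exact (hφ _ _).trans (cornerCell_gridVertex_top g 0)
  have hE0 : ∀ g c, φ (gridCorner σ twist hl g (c + 1) 0 0) = none := fun g c =>
    (hφ _ _).trans (cornerCell_gridVertex_top g (c + 1))
  have hE : ∀ g c r, c < 2 * l - 1 → r < 2 * l - 1 →
      φ (gridCorner σ twist hl g (c + 1) (r + 1) 0) = some (g, c, r + 1) := fun g c r hc hr =>
    (hφ _ _).trans (cornerCell_gridVertex_zero (by omega) (by omega))
  -- There are `2 * l - 1` columns of cells between `2 * l` columns of vertices. The cell column `c`
  -- is to the left of the vertex column `c + 1`, and row `0` consists of faces above the top row.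
  refine treewidth_le_of_three_grids (M := 2 * l - 1) (O := topFace σ twist hl 0 0) (cell := φ)
    (E := fun g c r => gridCorner σ twist hl g (c + 1) r 0) rfl (hφtop 0) (fun g c _ => hE0 g c)
    hE ?_ ?_ ?_ (by omega)
  · intro f g c r hf
    obtain ⟨g', rfl | ⟨c', r', hc', hr', rfl⟩⟩ := eq_topFace_or_eq_gridCorner (hl := hl) htwist f
    · rw [hφtop] at hf
      exact absurd hf (by simp)
    · rcases r' with _ | r'
      · rw [hE0] at hf
        exact absurd hf (by simp)
      · rw [hE g' c' r' (by omega) (by omega)] at hf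
        simp only [Option.some_inj, Prod.mk.injEq] at hf
        obtain ⟨rfl, rfl, rfl⟩ := hf
        exact ⟨by omega, by omega, by omega, rfl⟩
  · intro e x y h
    obtain ⟨v, d, hd, hxy⟩ := exists_corner_of_isLink h
    obtain ⟨w, hd⟩ := Option.isSome_iff_exists.1 hd
    by_cases hvw : v.1 = w.1
    swap
    · have h1 := cornerCell_of_link hd hvw
      left
      rcases hxy with ⟨rfl, rfl⟩ | ⟨rfl, rfl⟩
      · rw [hφ, hφ]
        exact h1
      · rw [hφ, hφ]
        exact h1.symm
    right
    set E := fun g c r => gridCorner σ twist hl g (c + 1) r 0 with hEdef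
    suffices hs : ∃ g c r, c < 2 * l - 1 ∧ r < 2 * l - 1 ∧ ∃ z,
        (z = topFace σ twist hl 0 0 ∨ z = E g c r ∨
          (c + 1 < 2 * l - 1 ∧ z = E g (c + 1) (r + 1))) ∧
        ((corner σ twist v d = E g c (r + 1) ∧ corner σ twist v (d - 1) = z) ∨
          (corner σ twist v d = z ∧ corner σ twist v (d - 1) = E g c (r + 1))) by
      obtain ⟨g, c, r, hc, hr, z, hz, hs⟩ := hs
      refine ⟨g, c, r, hc, hr, z, hz, ?_⟩
      rcases hxy with ⟨rfl, rfl⟩ | ⟨rfl, rfl⟩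
      · exact hs
      · exact hs.symm.imp And.symm And.symm
    -- The sides of a vertical edge: two horizontally adjacent cells, or a cell and the outer face
    -- at the left and right borders.
    have hup : ∀ g c r, c < 2 * l → r + 1 < 2 * l →
        ∃ g' c' r', c' < 2 * l - 1 ∧ r' < 2 * l - 1 ∧ ∃ z,
        (z = topFace σ twist hl 0 0 ∨ z = E g' c' r' ∨
          (c' + 1 < 2 * l - 1 ∧ z = E g' (c' + 1) (r' + 1))) ∧
        ((gridCorner σ twist hl g c (r + 1) 0 = E g' c' (r' + 1) ∧
            gridCorner σ twist hl g c (r + 1) 3 = z) ∨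
          (gridCorner σ twist hl g c (r + 1) 0 = z ∧
            gridCorner σ twist hl g c (r + 1) 3 = E g' c' (r' + 1))) := by
      intro g c r hc hr
      rcases c with _ | c
      · refine ⟨g, 0, r, by omega, by omega, _, Or.inl rfl, Or.inr ⟨?_, ?_⟩⟩
        · rw [gridCorner_left_eq_topFace g htwist hr, houter]
        · exact gridCorner_right_up g htwist (by omega)
      · by_cases hc' : c + 2 < 2 * l
        · exact ⟨g, c, r, by omega, by omega, _, Or.inr (Or.inr ⟨by omega, rfl⟩),
            Or.inl ⟨rfl, gridCorner_right_up g htwist hc'⟩⟩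
        · refine ⟨g, c, r, by omega, by omega, _, Or.inl rfl, Or.inl ⟨rfl, ?_⟩⟩
          rw [show c + 1 = 2 * l - 1 by omega, gridCorner_right_eq_topFace g htwist hr, houter]
    -- The sides of a horizontal edge: a cell and the face above it, which is a top face if `r = 0`,
    -- or at the bottom a cell and the outer face.
    have hleft : ∀ g c r, c + 1 < 2 * l → r < 2 * l →
        ∃ g' c' r', c' < 2 * l - 1 ∧ r' < 2 * l - 1 ∧ ∃ z,
        (z = topFace σ twist hl 0 0 ∨ z = E g' c' r' ∨
          (c' + 1 < 2 * l - 1 ∧ z = E g' (c' + 1) (r' + 1))) ∧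
        ((gridCorner σ twist hl g (c + 1) r 1 = E g' c' (r' + 1) ∧
            gridCorner σ twist hl g (c + 1) r 0 = z) ∨
          (gridCorner σ twist hl g (c + 1) r 1 = z ∧
            gridCorner σ twist hl g (c + 1) r 0 = E g' c' (r' + 1))) := by
      intro g c r hc hr
      by_cases hr' : r + 1 < 2 * l
      · exact ⟨g, c, r, by omega, by omega, _, Or.inr (Or.inl rfl),
          Or.inl ⟨gridCorner_down_left g htwist hr', rfl⟩⟩
      · refine ⟨g, c, r - 1, by omega, by omega, _, Or.inl rfl, Or.inr ⟨?_, ?_⟩⟩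
        · rw [show r = 2 * l - 1 by omega, gridCorner_bottom_eq_topFace g htwist hc, houter]
        · rw [hEdef, Nat.sub_add_cancel (by omega)]
    have hspec := neighbour_spec hd
    obtain ⟨g, ⟨c, hc⟩, ⟨r, hr⟩⟩ := v
    have hwc := w.2.1.2
    have hwr := w.2.2.2
    have hv : ∀ k, corner σ twist (g, ⟨c, hc⟩, ⟨r, hr⟩) k = gridCorner σ twist hl g c r k := by
      intro k
      rw [gridCorner, ← eq_gridVertex hl (g, ⟨c, hc⟩, ⟨r, hr⟩)]
    simp only [hv]
    dsimp only at hspec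
    rcases hspec with ⟨rfl, a1, a2, a3⟩ | ⟨rfl, a1, a2, a3⟩ | ⟨rfl, a1, a2, a3⟩ |
        ⟨rfl, a1, a2, a3⟩ | ⟨rfl, a1, a2, a3⟩
    · exact absurd hvw.symm a3
    · obtain ⟨r, rfl⟩ : ∃ r', r = r' + 1 := ⟨r - 1, by omega⟩
      exact hup g c r hc hr
    · obtain ⟨c, rfl⟩ : ∃ c', c = c' + 1 := ⟨c - 1, by omega⟩
      exact hleft g c r hc hr
    · obtain ⟨g', c', r', hc', hr', z, hz, hs⟩ := hup g c r hc (by omega)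
      refine ⟨g', c', r', hc', hr', z, hz, ?_⟩
      change (gridCorner σ twist hl g c r 2 = _ ∧ gridCorner σ twist hl g c r 1 = _) ∨
        (gridCorner σ twist hl g c r 2 = _ ∧ gridCorner σ twist hl g c r 1 = _)
      rw [gridCorner_down_left g htwist (by omega), gridCorner_down_right g htwist (by omega)]
      exact hs.symm.imp And.symm And.symm
    · obtain ⟨g', c', r', hc', hr', z, hz, hs⟩ := hleft g c r (by omega) hr
      refine ⟨g', c', r', hc', hr', z, hz, ?_⟩
      change (gridCorner σ twist hl g c r 3 = _ ∧ gridCorner σ twist hl g c r 2 = _) ∨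
        (gridCorner σ twist hl g c r 3 = _ ∧ gridCorner σ twist hl g c r 2 = _)
      rw [gridCorner_right_up g htwist (by omega), gridCorner_right_down g htwist (by omega)]
      exact hs.symm.imp And.symm And.symm
  · refine (Set.encard_le_encard ?_).trans hcard
    intro f hf
    obtain ⟨g, rfl | ⟨c, r, hc, hr, rfl⟩⟩ := eq_topFace_or_eq_gridCorner (hl := hl) htwist f
    · exact ⟨g, 0, by omega, rfl⟩
    · rcases r with _ | r
      · exact ⟨g, c + 1, by omega, (topFace_of_lt hc).symm⟩
      · change φ _ = none at hf
        rw [hE g c r (by omega) (by omega)] at hf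
        exact absurd hf (by simp)

end faces

end Todinca

/-! ### Identification of top faces across links, and their number -/

namespace Todinca

variable {l : ℕ}

section links

variable {σ : Fin 3 → Equiv.Perm (Fin l)} {twist : Sym2 (Vertex l) → Bool} {hl : 0 < l}

theorem leftTop_eq_gridVertex (g : Fin 3) (i : Fin l) : leftTop g i = gridVertex hl g i 0 :=
  eq_gridVertex hl (leftTop g i)

theorem rightTop_eq_gridVertex (g : Fin 3) (i : Fin l) :
    rightTop g i = gridVertex hl g (2 * l - 1 - i) 0 :=
  eq_gridVertex hl (rightTop g i)

theorem topFace_leftTop (htwist : ∀ u v : Vertex l, u.1 = v.1 → twist s(u, v) = false)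
    (g : Fin 3) (i : Fin l) :
    corner σ twist (leftTop g i) 0 = topFace σ twist hl g i ∧
      corner σ twist (leftTop g i) 3 = topFace σ twist hl g (i + 1) := by
  rw [leftTop_eq_gridVertex (hl := hl)]
  exact ⟨(topFace_of_lt (by omega)).symm, gridCorner_three_top g htwist (by omega)⟩

theorem topFace_rightTop (htwist : ∀ u v : Vertex l, u.1 = v.1 → twist s(u, v) = false)
    (g : Fin 3) (i : Fin l) :
    corner σ twist (rightTop g i) 3 = topFace σ twist hl g (2 * l - i) ∧
      corner σ twist (rightTop g i) 0 = topFace σ twist hl g (2 * l - (i + 1)) := by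
  rw [rightTop_eq_gridVertex (hl := hl)]
  have h1 : 2 * l - ((i : ℕ) + 1) = 2 * l - 1 - i := by omega
  have h2 : 2 * l - (i : ℕ) = 2 * l - 1 - i + 1 := by omega
  rw [h1, h2]
  exact ⟨gridCorner_three_top g htwist (by omega), (topFace_of_lt (by omega)).symm⟩

/-- The gap before an untwisted link on one grid is the gap after it on the other. Since `rightTop`
counts from the right, gaps on both grids are then counted in the same sense, from `i` and from `2 *
l - σ g i` downwards. -/
theorem topFace_link (htwist : ∀ u v : Vertex l, u.1 = v.1 → twist s(u, v) = false)
    {g : Fin 3} {i : Fin l} (h : twist s(leftTop g i, rightTop (g + 1) (σ g i)) = false) :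
    topFace σ twist hl g i = topFace σ twist hl (g + 1) (2 * l - σ g i) ∧
      topFace σ twist hl g (i + 1) = topFace σ twist hl (g + 1) (2 * l - (σ g i + 1)) := by
  obtain ⟨h1, h2⟩ := topFace_leftTop (σ := σ) (hl := hl) htwist g i
  obtain ⟨h3, h4⟩ := topFace_rightTop (σ := σ) (hl := hl) htwist (g + 1) (σ g i)
  rw [← h1, ← h2, ← h3, ← h4]
  refine ⟨corner_along (neighbour_leftTop σ g i) (neighbour_rightTop σ g i) h,
    (corner_along (neighbour_rightTop σ g i) (neighbour_leftTop σ g i) ?_).symm⟩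
  rw [Sym2.eq_swap]
  exact h

theorem topFace_link_twisted (htwist : ∀ u v : Vertex l, u.1 = v.1 → twist s(u, v) = false)
    {g : Fin 3} {i : Fin l} (h : twist s(leftTop g i, rightTop (g + 1) (σ g i)) = true) :
    topFace σ twist hl g i = topFace σ twist hl (g + 1) (2 * l - (σ g i + 1)) ∧
      topFace σ twist hl g (i + 1) = topFace σ twist hl (g + 1) (2 * l - σ g i) := by
  obtain ⟨h1, h2⟩ := topFace_leftTop (σ := σ) (hl := hl) htwist g i
  obtain ⟨h3, h4⟩ := topFace_rightTop (σ := σ) (hl := hl) htwist (g + 1) (σ g i)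
  rw [← h1, ← h2, ← h3, ← h4]
  exact corner_along_twisted (neighbour_leftTop σ g i) (neighbour_rightTop σ g i) h

theorem topFace_ladder (htwist : ∀ u v : Vertex l, u.1 = v.1 → twist s(u, v) = false)
    {g : Fin 3} (hσ : σ g = Equiv.refl _)
    (h : ∀ i, twist s(leftTop g i, rightTop (g + 1) (σ g i)) = false) {j : ℕ} (hj : j ≤ l) :
    topFace σ twist hl g j = topFace σ twist hl (g + 1) (2 * l - j) := by
  rcases j with _ | j
  · have := (topFace_link (hl := hl) htwist (h ⟨0, hl⟩)).1
    rwa [hσ] at this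
  · have := (topFace_link (hl := hl) htwist (h ⟨j, hj⟩)).2
    rwa [hσ] at this

end links

/-- Given faces `T g j` above the top rows of the three grids, of which those that lie between
two grids are identified as in a Todinca graph with ladders between `A` and `B` and between `C`
and `A`, there are at most `3 l - 1 - |B|` of them if those of index in `B` at the right of `C` are
redundant. -/
theorem encard_topFaces_le {X : Type} {T : Fin 3 → ℕ → X} (hl : 0 < l)
    (hlast : ∀ g, T g (2 * l) = T g 0)
    (hAB : ∀ j ≤ l, T 0 j = T 1 (2 * l - j)) (hCA : ∀ j ≤ l, T 2 j = T 0 (2 * l - j))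
    (hBC : ∀ j ≤ l, ∃ j' ≤ l, T 1 j = T 2 (2 * l - j'))
    (hBC_first : T 1 0 = T 2 (2 * l))
    (B : Finset ℕ) (hBl : ∀ b ∈ B, b ≤ l)
    (hB : ∀ b ∈ B, ∃ j ≤ l, j ∉ B ∧ T 2 (2 * l - b) = T 2 (2 * l - j)) :
    {f | ∃ g j, j ≤ 2 * l ∧ f = T g j}.encard ≤ ((3 * l - 1 - B.card : ℕ) : ℕ∞) := by
  classical
  -- This keeps the subtraction in `l + 1 - B.card` from being truncated.
  have hcard : B.card ≤ l + 1 := by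
    have := Finset.card_le_card (s := B) (t := Finset.range (l + 1))
      (fun b hb => Finset.mem_range.2 (Nat.lt_succ_of_le (hBl b hb)))
    rwa [Finset.card_range] at this
  -- Representatives of all top faces. The right half of C includes the outer face (`j = 0`) and the
  -- central face (`j = l`), so the left halves of A and C contribute only `l - 1` gaps each. The
  -- ladders and `hBC` reduce the other gaps to these.
  let S : Finset X := ((Finset.Ioo 0 l).image (T 0) ∪ (Finset.Ioo 0 l).image (T 2)) ∪
    (Finset.range (l + 1) \ B).image fun j => T 2 (2 * l - j)
  have hS : S.card ≤ 3 * l - 1 - B.card := by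
    refine (Finset.card_union_le _ _).trans ?_
    have h1 : ((Finset.Ioo 0 l).image (T 0) ∪ (Finset.Ioo 0 l).image (T 2)).card ≤
        (l - 1) + (l - 1) := by
      refine (Finset.card_union_le _ _).trans (Nat.add_le_add ?_ ?_) <;>
      · refine Finset.card_image_le.trans ?_
        rw [Nat.card_Ioo]
        omega
    have h2 : ((Finset.range (l + 1) \ B).image fun j => T 2 (2 * l - j)).card ≤
        l + 1 - B.card := by
      refine Finset.card_image_le.trans ?_
      rw [Finset.card_sdiff_of_subset
        (fun b hb => Finset.mem_range.2 (Nat.lt_succ_of_le (hBl b hb))), Finset.card_range]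
    omega
  have hright : ∀ j ≤ l, T 2 (2 * l - j) ∈ S := by
    intro j hj
    obtain ⟨j', hj', hjB, e⟩ : ∃ j' ≤ l, j' ∉ B ∧ T 2 (2 * l - j) = T 2 (2 * l - j') := by
      by_cases h : j ∈ B
      · exact hB j h
      · exact ⟨j, hj, h, rfl⟩
    rw [e]
    refine Finset.mem_union_right _ (Finset.mem_image.2 ⟨j', ?_, rfl⟩)
    exact Finset.mem_sdiff.2 ⟨Finset.mem_range.2 (Nat.lt_succ_of_le hj'), hjB⟩
  have h2 : ∀ j ≤ 2 * l, T 2 j ∈ S := by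
    intro j hj
    by_cases h : l ≤ j
    · have := hright (2 * l - j) (by omega)
      rwa [show 2 * l - (2 * l - j) = j by omega] at this
    · rcases Nat.eq_zero_or_pos j with rfl | h0
      · rw [← hlast]
        exact hright 0 (by omega)
      · exact Finset.mem_union_left _ (Finset.mem_union_right _
          (Finset.mem_image.2 ⟨j, Finset.mem_Ioo.2 ⟨h0, by omega⟩, rfl⟩))
  have h0 : ∀ j ≤ 2 * l, T 0 j ∈ S := by
    intro j hj
    by_cases h : l ≤ j
    · have := hCA (2 * l - j) (by omega)
      rw [show 2 * l - (2 * l - j) = j by omega] at this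
      rw [← this]
      exact h2 _ (by omega)
    · rcases Nat.eq_zero_or_pos j with rfl | h0
      · rw [hAB 0 (by omega), Nat.sub_zero, hlast, hBC_first]
        exact h2 _ le_rfl
      · exact Finset.mem_union_left _ (Finset.mem_union_left _
          (Finset.mem_image.2 ⟨j, Finset.mem_Ioo.2 ⟨h0, by omega⟩, rfl⟩))
  have h1 : ∀ j ≤ 2 * l, T 1 j ∈ S := by
    intro j hj
    by_cases h : j ≤ l
    · obtain ⟨j', hj', e⟩ := hBC j h
      rw [e]
      exact h2 _ (by omega)
    · have := hAB (2 * l - j) (by omega)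
      rw [show 2 * l - (2 * l - j) = j by omega] at this
      rw [← this]
      exact h0 _ (by omega)
  refine (Set.encard_le_encard (t := (S : Set X)) ?_).trans ?_
  · rintro _ ⟨g, j, hj, rfl⟩
    fin_cases g
    exacts [h0 j hj, h1 j hj, h2 j hj]
  · rw [Set.encard_coe_eq_coe_finsetCard]
    exact_mod_cast hS

end Todinca

/-! ### Handles, crosscaps and the final count -/

namespace Todinca

variable {l : ℕ}

/-- A bound on the tree-width of the dual for a Todinca graph with two ladders and a gadget `τ`
between the grids `B` and `C`, where the faces above the top row of `C` that have an index in `J`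
(counted from the right) also have an index that is not in `J`. -/
theorem treewidth_ladderExcept_le {τ : Equiv.Perm (Fin l)} {twist : Sym2 (Vertex l) → Bool}
    {hl : 0 < l} (htwist : ∀ u v : Vertex l, u.1 = v.1 → twist s(u, v) = false)
    (hladder : ∀ g i, g ≠ 1 → twist s(leftTop g i, rightTop (g + 1) (ladderExcept τ g i)) = false)
    (hfirst : (τ ⟨0, hl⟩ : ℕ) = 0)
    (hfirst_twist : twist s(leftTop 1 ⟨0, hl⟩, rightTop 2 (τ ⟨0, hl⟩)) = false)
    (J : Finset ℕ) (hJl : ∀ b ∈ J, b ≤ l)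
    (hJ : ∀ b ∈ J, ∃ j ≤ l, j ∉ J ∧
      topFace (ladderExcept τ) twist hl 2 (2 * l - b) =
        topFace (ladderExcept τ) twist hl 2 (2 * l - j))
    {w : ℕ} (hw : 2 * l ≤ w) (hwJ : 3 * l - 1 - J.card ≤ w + 1) :
    treewidth (embedding (ladderExcept τ) twist).dual ≤ (w : ℕ∞) := by
  set T := topFace (ladderExcept τ) twist hl with hT
  have hlast : ∀ g, T g (2 * l) = T g 0 := fun g => topFace_last g htwist
  have hAB : ∀ j ≤ l, T 0 j = T 1 (2 * l - j) := fun j hj =>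
    topFace_ladder htwist (g := 0) rfl (fun i => hladder 0 i (by decide)) hj
  have hCA : ∀ j ≤ l, T 2 j = T 0 (2 * l - j) := fun j hj =>
    topFace_ladder htwist (g := 2) rfl (fun i => hladder 2 i (by decide)) hj
  have hBC_first : T 1 0 = T 2 (2 * l) := by
    have h : T 1 0 = T 2 (2 * l - (τ ⟨0, hl⟩ : Fin l)) :=
      (topFace_link (σ := ladderExcept τ) (hl := hl) (g := 1) htwist hfirst_twist).1
    rwa [hfirst, Nat.sub_zero] at h
  -- A gap with `j > 0` is read off the link just before it; a twist only changes on which side of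
  -- the other end of the link the face lies.
  have hBC : ∀ j ≤ l, ∃ j' ≤ l, T 1 j = T 2 (2 * l - j') := by
    intro j hj
    rcases j with _ | j
    · exact ⟨0, hl.le, hBC_first⟩
    · have hi := (τ ⟨j, hj⟩).2
      cases ht : twist s(leftTop 1 ⟨j, hj⟩, rightTop 2 (τ ⟨j, hj⟩))
      · exact ⟨_, hi, (topFace_link (σ := ladderExcept τ) (hl := hl) (g := 1) htwist ht).2⟩
      · exact ⟨_, hi.le,
          (topFace_link_twisted (σ := ladderExcept τ) (hl := hl) (g := 1) htwist ht).2⟩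
  refine treewidth_dual_le (hl := hl) htwist ?_ ?_ hw
  -- The outer faces agree because the outermost rungs of the two ladders border the outer face of A
  -- and that of B, or of C.
  · intro g
    change T g 0 = T 0 0
    fin_cases g
    · rfl
    · exact (hlast 1).symm.trans (hAB 0 hl.le).symm
    · exact (hCA 0 hl.le).trans (hlast 0)
  · refine (encard_topFaces_le hl hlast hAB hCA hBC hBC_first J hJl hJ).trans ?_
    exact_mod_cast hwJ

theorem repeatPerm_apply {k m : ℕ} (τ : Equiv.Perm (Fin m)) (t : Fin k) (o : Fin m) :
    repeatPerm k τ (finProdFinEquiv (t, o)) = finProdFinEquiv (t, τ o) := by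
  simp [repeatPerm]

section gadgets

variable {k m : ℕ} {τ : Equiv.Perm (Fin m)} {twist : Sym2 (Vertex (k * m)) → Bool}
  {hl : 0 < k * m}

/-- The faces at a link of a repeated gadget that is not twisted. -/
theorem topFace_repeatPerm (htwist : ∀ u v : Vertex (k * m), u.1 = v.1 → twist s(u, v) = false)
    {t o o' : ℕ} (ht : t < k) (ho : o < m) (ho' : (τ ⟨o, ho⟩ : ℕ) = o')
    (h : twist s(leftTop 1 (finProdFinEquiv (⟨t, ht⟩, ⟨o, ho⟩)),
      rightTop 2 (repeatPerm k τ (finProdFinEquiv (⟨t, ht⟩, ⟨o, ho⟩)))) = false) :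
    topFace (ladderExcept (repeatPerm k τ)) twist hl 1 (o + m * t) =
        topFace (ladderExcept (repeatPerm k τ)) twist hl 2 (2 * (k * m) - (o' + m * t)) ∧
      topFace (ladderExcept (repeatPerm k τ)) twist hl 1 (o + m * t + 1) =
        topFace (ladderExcept (repeatPerm k τ)) twist hl 2 (2 * (k * m) - (o' + m * t + 1)) := by
  have h1 := topFace_link (σ := ladderExcept (repeatPerm k τ)) (hl := hl) (g := 1) htwist h
  have e : ladderExcept (repeatPerm k τ) 1 (finProdFinEquiv (⟨t, ht⟩, ⟨o, ho⟩)) =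
      finProdFinEquiv (⟨t, ht⟩, τ ⟨o, ho⟩) := repeatPerm_apply τ _ _
  rw [e] at h1
  simp only [finProdFinEquiv_apply_val, ho'] at h1
  exact h1

/-- The faces at a link of a repeated gadget that is twisted. -/
theorem topFace_repeatPerm_twisted
    (htwist : ∀ u v : Vertex (k * m), u.1 = v.1 → twist s(u, v) = false)
    {t o o' : ℕ} (ht : t < k) (ho : o < m) (ho' : (τ ⟨o, ho⟩ : ℕ) = o')
    (h : twist s(leftTop 1 (finProdFinEquiv (⟨t, ht⟩, ⟨o, ho⟩)),
      rightTop 2 (repeatPerm k τ (finProdFinEquiv (⟨t, ht⟩, ⟨o, ho⟩)))) = true) :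
    topFace (ladderExcept (repeatPerm k τ)) twist hl 1 (o + m * t) =
      topFace (ladderExcept (repeatPerm k τ)) twist hl 2 (2 * (k * m) - (o' + m * t + 1)) := by
  have h1 := topFace_link_twisted (σ := ladderExcept (repeatPerm k τ)) (hl := hl) (g := 1) htwist h
  have e : ladderExcept (repeatPerm k τ) 1 (finProdFinEquiv (⟨t, ht⟩, ⟨o, ho⟩)) =
      finProdFinEquiv (⟨t, ht⟩, τ ⟨o, ho⟩) := repeatPerm_apply τ _ _
  rw [e] at h1
  simp only [finProdFinEquiv_apply_val, ho'] at h1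
  exact h1.1

theorem repeatPerm_first (hm : 0 < m) (h0 : (τ ⟨0, hm⟩ : ℕ) = 0) :
    (repeatPerm k τ ⟨0, hl⟩ : ℕ) = 0 := by
  have hk : 0 < k := Nat.pos_of_mul_pos_right hl
  have e : (⟨0, hl⟩ : Fin (k * m)) = finProdFinEquiv (⟨0, hk⟩, ⟨0, hm⟩) := by
    ext; simp
  rw [e, repeatPerm_apply]
  simp [h0]

end gadgets

/-- The gap `p` of B lies between links whose other ends are at `p - 1` and `2 * p`, so it equals
the gaps `p` and `2 * p` of C. The gap `4 * p` of B lies between links that end at `2 * p - 1` and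
`4 * p`, so the gaps `2 * p` and `4 * p` of C coincide too. All positions are relative to the start
`5 * p * t` of the gadget, and those in C are counted from the right. -/
theorem handle_redundant {k p t : ℕ} (hp : 0 < p) (ht : t < k) (hl : 0 < k * (5 * p)) :
    let R := fun j => topFace (handleLinks k p) (fun _ => false) hl 2 (2 * (k * (5 * p)) - j)
    R (p * (5 * t + 2)) = R (p * (5 * t + 1)) ∧ R (p * (5 * t + 4)) = R (p * (5 * t + 1)) := by
  intro R
  have key := fun (o o' : ℕ) (ho : o < 5 * p) (ho' : (handlePerm p ⟨o, ho⟩ : ℕ) = o') =>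
    topFace_repeatPerm (τ := handlePerm p) (hl := hl) (twist := fun _ => false)
      (fun _ _ _ => rfl) ht ho ho' rfl
  have h1 := (key (p - 1) (p - 1) (by omega)
    (by simp only [handlePerm, Equiv.coe_fn_mk]; split_ifs <;> omega)).2
  have h2 := (key p (2 * p) (by omega)
    (by simp only [handlePerm, Equiv.coe_fn_mk]; split_ifs <;> omega)).1
  have h3 := (key (4 * p - 1) (2 * p - 1) (by omega)
    (by simp only [handlePerm, Equiv.coe_fn_mk]; split_ifs <;> omega)).2
  have h4 := (key (4 * p) (4 * p) (by omega)
    (by simp only [handlePerm, Equiv.coe_fn_mk]; split_ifs <;> omega)).1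
  have e1 : p - 1 + 5 * p * t + 1 = p + 5 * p * t := by omega
  have e2 : 4 * p - 1 + 5 * p * t + 1 = 4 * p + 5 * p * t := by omega
  have e3 : 2 * p - 1 + 5 * p * t + 1 = 2 * p + 5 * p * t := by omega
  rw [e1] at h1
  rw [e2, e3] at h3
  have f1 : p * (5 * t + 1) = p + 5 * p * t := by ring
  have f2 : p * (5 * t + 2) = 2 * p + 5 * p * t := by ring
  have f4 : p * (5 * t + 4) = 4 * p + 5 * p * t := by ring
  rw [f1, f2, f4]
  have h5 := h2.symm.trans h1
  exact ⟨h5, (h4.symm.trans h3).trans h5⟩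

theorem treewidth_orientable_le (k p : ℕ) (hk : 0 < k) (hp : 1 < p) :
    treewidth (orientableTodincaEmbedding k p).dual ≤ ((15 * k * p - (2 + 2 * k) : ℕ) : ℕ∞) := by
  -- With these rewritings all bounds are linear in `k` and the single product `k * p`, as `omega`
  -- requires.
  have hkp : k * 2 ≤ k * p := Nat.mul_le_mul_left k hp
  have hl5 : k * (5 * p) = 5 * (k * p) := by ring
  have hl15 : 15 * k * p = 15 * (k * p) := by ring
  have hl : 0 < k * (5 * p) := by omega
  have hinj : ∀ a, Function.Injective fun t : ℕ => p * (5 * t + a) := fun a t t' h => by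
    have := Nat.eq_of_mul_eq_mul_left (by omega) h
    omega
  -- Two redundant gaps per handle. With the factor `p` in front, distinctness reduces after
  -- cancellation to residues modulo `5`.
  let J : Finset ℕ := (Finset.range k).image (fun t => p * (5 * t + 2)) ∪
    (Finset.range k).image (fun t => p * (5 * t + 4))
  have hmem : ∀ b, b ∈ J ↔ ∃ t < k, b = p * (5 * t + 2) ∨ b = p * (5 * t + 4) := by
    intro b
    simp only [J, Finset.mem_union, Finset.mem_image, Finset.mem_range]
    constructor
    · rintro (⟨t, h, rfl⟩ | ⟨t, h, rfl⟩)
      exacts [⟨t, h, Or.inl rfl⟩, ⟨t, h, Or.inr rfl⟩]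
    · rintro ⟨t, h, rfl | rfl⟩
      exacts [Or.inl ⟨t, h, rfl⟩, Or.inr ⟨t, h, rfl⟩]
  have hJ : J.card = 2 * k := by
    rw [Finset.card_union_of_disjoint, Finset.card_image_of_injective _ (hinj 2),
      Finset.card_image_of_injective _ (hinj 4), Finset.card_range]
    · omega
    · rw [Finset.disjoint_left]
      intro b h1 h2
      obtain ⟨t, -, rfl⟩ := Finset.mem_image.1 h1
      obtain ⟨t', -, h⟩ := Finset.mem_image.1 h2
      have := Nat.eq_of_mul_eq_mul_left (by omega) h
      omega
  have hle : ∀ t < k, ∀ a ≤ 5, p * (5 * t + a) ≤ k * (5 * p) := fun t ht a ha => by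
    have : p * (5 * t + a) ≤ p * (5 * k) := Nat.mul_le_mul_left p (by omega)
    rw [show p * (5 * k) = k * (5 * p) by ring] at this
    exact this
  refine treewidth_ladderExcept_le (hl := hl) (fun _ _ _ => rfl) (fun _ _ _ => rfl)
    (repeatPerm_first (by omega) ?_) rfl J ?_ ?_ ?_ ?_
  · simp only [handlePerm, Equiv.coe_fn_mk]
    split_ifs <;> omega
  · intro b hb
    obtain ⟨t, ht, rfl | rfl⟩ := (hmem b).1 hb
    exacts [hle t ht 2 (by omega), hle t ht 4 (by omega)]
  · intro b hb
    obtain ⟨t, ht, hbt⟩ := (hmem b).1 hb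
    have hR := handle_redundant (by omega : 0 < p) ht hl
    refine ⟨p * (5 * t + 1), hle t ht 1 (by omega), fun h => ?_, ?_⟩
    · obtain ⟨t', -, h | h⟩ := (hmem _).1 h
      · have := Nat.eq_of_mul_eq_mul_left (by omega) h
        omega
      · have := Nat.eq_of_mul_eq_mul_left (by omega) h
        omega
    · rcases hbt with rfl | rfl
      exacts [hR.1, hR.2]
  · omega
  · omega

/-- A link joins the left half of a top row to a right half, so equal unordered pairs match without
being swapped and the position of the left end can be read off. This decides which links are
twisted. -/
theorem mem_crosscapEdges_iff {k p : ℕ} (g : Fin 3) (j : Fin (k * (3 * p))) (t : Fin k)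
    (o : Fin (3 * p)) : s(leftTop g (finProdFinEquiv (t, o)), rightTop (g + 1) j) ∈
      crosscapEdges k p ↔ g = 1 ∧ p ≤ (o : ℕ) ∧ (o : ℕ) < 2 * p ∧
        j = crosscapLinks k p 1 (finProdFinEquiv (t, o)) := by
  constructor
  · rintro ⟨t', o', h1, h2, h⟩
    rcases Sym2.eq_iff.1 h with ⟨h3, h4⟩ | ⟨h3, -⟩
    · simp only [leftTop, Prod.mk.injEq, Fin.mk.injEq, and_true] at h3
      obtain ⟨rfl, h3⟩ := h3
      have h5 := finProdFinEquiv.injective (Fin.ext h3)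
      rw [Prod.mk.injEq] at h5
      obtain ⟨rfl, rfl⟩ := h5
      simp only [rightTop, Prod.mk.injEq, Fin.mk.injEq, and_true] at h4
      exact ⟨rfl, h1, h2, Fin.ext (by omega)⟩
    · simp only [leftTop, rightTop, Prod.mk.injEq, Fin.mk.injEq, and_true] at h3
      omega
  · rintro ⟨rfl, h1, h2, rfl⟩
    exact ⟨t, o, h1, h2, rfl⟩

theorem not_mem_crosscapEdges {k p : ℕ} {u v : Vertex (k * (3 * p))} (h : u.1 = v.1) :
    s(u, v) ∉ crosscapEdges k p := by
  rintro ⟨t, o, -, -, h'⟩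
  rcases Sym2.eq_iff.1 h' with ⟨rfl, rfl⟩ | ⟨rfl, rfl⟩
  · exact absurd h (by simp [leftTop, rightTop])
  · exact absurd h (by simp [leftTop, rightTop])

-- The gap `p` of B, relative to the gadget, lies between an untwisted link that ends at `p - 1` and
-- a twisted one that ends at `2 * p - 1`. The first identifies it with the gap `p` of C. The
-- second, because of the twist, identifies it with the gap on the far side of `2 * p - 1`, which is
-- `2 * p`.
open Classical in
theorem crosscap_redundant {k p t : ℕ} (hp : 0 < p) (ht : t < k) (hl : 0 < k * (3 * p)) :
    let R := fun j => topFace (crosscapLinks k p) (fun e => decide (e ∈ crosscapEdges k p)) hl 2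
      (2 * (k * (3 * p)) - j)
    R (p * (3 * t + 2)) = R (p * (3 * t + 1)) := by
  intro R
  have htw : ∀ u v : Vertex (k * (3 * p)), u.1 = v.1 →
      decide (s(u, v) ∈ crosscapEdges k p) = false := fun u v h => by
    simpa using not_mem_crosscapEdges h
  have h1 := (topFace_repeatPerm (τ := crosscapPerm p) (hl := hl) (o := p - 1) (o' := p - 1)
    (twist := fun e => decide (e ∈ crosscapEdges k p)) htw ht (by omega)
    (by simp only [crosscapPerm, Equiv.coe_fn_mk]; split_ifs <;> omega)
    (by
      refine decide_eq_false fun h => ?_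
      have := ((mem_crosscapEdges_iff 1 _ _ _).1 h).2.1
      dsimp only at this
      omega)).2
  have h2 := topFace_repeatPerm_twisted (τ := crosscapPerm p) (hl := hl) (o := p)
    (o' := 2 * p - 1) (twist := fun e => decide (e ∈ crosscapEdges k p)) htw ht (by omega)
    (by simp only [crosscapPerm, Equiv.coe_fn_mk]; split_ifs <;> omega)
    (by
      refine decide_eq_true ((mem_crosscapEdges_iff 1 _ _ _).2 ⟨rfl, le_rfl, ?_, rfl⟩)
      dsimp only
      omega)
  have e1 : p - 1 + 3 * p * t + 1 = p + 3 * p * t := by omega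
  have e3 : 2 * p - 1 + 3 * p * t + 1 = 2 * p + 3 * p * t := by omega
  rw [e1] at h1
  rw [e3] at h2
  have f1 : p * (3 * t + 1) = p + 3 * p * t := by ring
  have f2 : p * (3 * t + 2) = 2 * p + 3 * p * t := by ring
  rw [f1, f2]
  exact h2.symm.trans h1

open Classical in
theorem treewidth_nonorientable_le (k p : ℕ) (hk : 0 < k) (hp : 1 < p) :
    treewidth (nonorientableTodincaEmbedding k p).dual ≤ ((9 * k * p - (2 + k) : ℕ) : ℕ∞) := by
  have hkp : k * 2 ≤ k * p := Nat.mul_le_mul_left k hp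
  have hl3 : k * (3 * p) = 3 * (k * p) := by ring
  have hl9 : 9 * k * p = 9 * (k * p) := by ring
  have hl : 0 < k * (3 * p) := by omega
  have hinj : Function.Injective fun t : ℕ => p * (3 * t + 2) := fun t t' h => by
    have := Nat.eq_of_mul_eq_mul_left (by omega) h
    omega
  -- One redundant gap per crosscap, at the end of its middle block.
  let J : Finset ℕ := (Finset.range k).image fun t => p * (3 * t + 2)
  have hmem : ∀ b, b ∈ J ↔ ∃ t < k, p * (3 * t + 2) = b := by
    intro b
    simp only [J, Finset.mem_image, Finset.mem_range]
  have hJ : J.card = k := by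
    rw [Finset.card_image_of_injective _ hinj, Finset.card_range]
  have hle : ∀ t < k, ∀ a ≤ 3, p * (3 * t + a) ≤ k * (3 * p) := fun t ht a ha => by
    have : p * (3 * t + a) ≤ p * (3 * k) := Nat.mul_le_mul_left p (by omega)
    rw [show p * (3 * k) = k * (3 * p) by ring] at this
    exact this
  refine treewidth_ladderExcept_le (hl := hl) ?_ ?_ (repeatPerm_first (by omega) ?_) ?_ J ?_ ?_
    ?_ ?_
  · intro u v h
    exact decide_eq_false (not_mem_crosscapEdges h)
  · intro g i hg
    obtain ⟨⟨t, o⟩, rfl⟩ := finProdFinEquiv.surjective i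
    exact decide_eq_false fun h => hg ((mem_crosscapEdges_iff _ _ _ _).1 h).1
  · simp only [crosscapPerm, Equiv.coe_fn_mk]
    split_ifs <;> omega
  · refine decide_eq_false fun h => ?_
    have e : (⟨0, hl⟩ : Fin (k * (3 * p))) = finProdFinEquiv (⟨0, hk⟩, ⟨0, by omega⟩) := by
      ext; simp
    rw [e] at h
    have := ((mem_crosscapEdges_iff 1 _ _ _).1 h).2.1
    dsimp only at this
    omega
  · intro b hb
    obtain ⟨t, ht, rfl⟩ := (hmem b).1 hb
    exact hle t ht 2 (by omega)
  · intro b hb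
    obtain ⟨t, ht, rfl⟩ := (hmem b).1 hb
    refine ⟨p * (3 * t + 1), hle t ht 1 (by omega), fun h => ?_,
      crosscap_redundant (by omega) ht hl⟩
    obtain ⟨t', -, h⟩ := (hmem _).1 h
    have := Nat.eq_of_mul_eq_mul_left (by omega) h
    omega
  · omega
  · omega

end Todinca

theorem mainTheorem6 (k p : ℕ) (hk : 0 < k) (hp : 1 < p) :
    treewidth (orientableTodincaEmbedding k p).dual ≤ ((15 * k * p - (2 + 2 * k) : ℕ) : ℕ∞) ∧
      treewidth (nonorientableTodincaEmbedding k p).dual ≤ ((9 * k * p - (2 + k) : ℕ) : ℕ∞) :=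
  ⟨treewidth_orientable_le k p hk hp, treewidth_nonorientable_le k p hk hp⟩
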